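/- \textbf{Setting.} Let $h\in\mathbb R$, $c\in\mathbb C$, and let $\Delta_1,\dots,\Delta_n\in\mathbb C$; write $\Sigma\Delta=\sum_{k}\Delta_k$ and $\mathrm B[x;y]=\Gamma(x)\Gamma(y-x)/\Gamma(y)$. Consider a tree diagram with boundary points $0,1,\dots,n,n+1$ all of whose bulk vertices are at least trivalent. Let $A_1,\dots,A_r$ be the vertices, in order, on the path joining the vertex of point $0$ to the vertex of point $n+1$. Identifying $0$ with $n+1$ produces a one-loop diagram with loop vertices $A_1,\dots,A_r$. Every other vertex lies on a tree attached to some $A_p$; it has a parent (the next vertex towards the loop), and the children of a vertex $v$ are written $(v,m)$. For a vertex $v$, $A_v$ is the set of points of $\{1,\dots,n\}$ attached to $v$ and $A_{(v)}$ the set of those attached to $v$ or to its descendants; in particular $A_{(p)}$ collects the points on $A_p$ and on its trees. Put $\Delta_{A_v}=\sum_{k\in A_v}\Delta_k$. The new Mellin variables $\delta_{ij}$ ($1\le i<j\le n$) satisfy $\sum_{j\ne k}\delta_{jk}=\Delta_k$. The old ones, $\tau_{ij}$, $\tau_{0k}$, $\tau_{k\,n+1}$ (with $\tau_{0\,n+1}=0$),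 satisfy $$\Delta_k=\tau_{0k}+\tau_{k\,n+1}+\sum_{j\neq k}\tau_{jk},\qquad 2c=\sum_{k}(\tau_{k\,n+1}-\tau_{0k}),\qquad \tfrac{\Sigma\Delta}{2}-h=\sum_{i<j}\tau_{ij}.$$ The loop formation kernel is $K_{\rm pre}=K_2K_1$ with $$K_2=\prod_{k=1}^n\frac{\Gamma(\tau_{0k})\Gamma(\tau_{k\,n+1})}{\Gamma(\tau_{0k}+\tau_{k\,n+1})},\qquad K_1=\prod_{i<j}\frac{\Gamma(\tau_{ij})\Gamma(\delta_{ij}-\tau_{ij})}{\Gamma(\delta_{ij})}.$$ For a set $S$ of points put $\xi_S=\sum_{i\in S}\Delta_i-2\sum_{i<j\in S}\tau_{ij}$, and let $s_S$ be the same expression in $\delta$. Set $\xi_{a,b}=\xi_{A_{(a)}\sqcup\cdots\sqcup A_{(b)}}$ (so $\xi_{1,r}=2h$, and $\xi_{a,b}=0$ for $a>b$), $\Xi_{(v)}=\xi_{A_{(v)}}$ (so $\Xi_{(p)}=\xi_{p,p}$), and $$\Xi_a=h+c+\xi_{a,r}-2\sum_{k\in A_{(a)}\sqcup\cdots\sqcup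 A_{(r)}}\tau_{k\,n+1}\qquad(\text{so }\Xi_1=h-c,\ \Xi_{r+1}=h+c);$$ define $s_{a,b}$ and $s_{(v)}$ likewise from $\delta$. All integrals run upwards along vertical lines, with measure $dz/(2\pi i)$ for each variable, through a point at which $\tau_{0k},\tau_{k\,n+1},\tau_{ij},\delta_{ij}-\tau_{ij}$ all have positive real part (so that left and right poles are separated). \textbf{Statement.} \begin{enumerate} \item \emph{$K_2$ is as for a necklace.} Fix the $\tau_{ij}$ and all Mandelstam variables, i.e. fix $\sum_{k\in A_{(a)}}\tau_{k\,n+1}$ for $a=1,\dots,r$. For any choice of one variable $\tau_{k\,n+1}$, $k\in A_{(a)}$, to be solved for in each group, the integral of $K_2$ over the remaining $\tau_{k\,n+1}$ converges absolutely and equals $$K_2^{\rm red}=\prod_{a=1}^r\frac{\Gamma\big(\frac{(\xi_{a,r}-\xi_{a+1,r})-(\Xi_a-\Xi_{a+1})}{2}\big)\,\Gamma\big(\frac{(\Xi_a-\Xi_{a+1})-(\xi_{1,a-1}-\xi_{1,a})}{2}\big)}{\Gamma\big(\frac{(\xi_{a,r}-\xi_{a+1,r})-(\xi_{1,a-1}-\xi_{1,a})}{2}\big)}.$$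 \item \emph{$K_1$.} Fix all $\xi_{a,b}$ and $\Xi_{(v)}$, i.e. fix the sum of the $\tau_{ij}$ in each of the following groups: for $a<b$, those with one point in $A_{(a)}$ and the other in $A_{(b)}$; for each vertex $v$ other than a trivalent loop vertex, those with $i,j\in A_{(v)}$ but not both in the same $A_{(v,m)}$. For any choice of one variable to be solved for in each group, the integral of $K_1$ over the remaining $\tau_{ij}$ converges absolutely and equals $$K_1^{\rm red}=\prod_{1\le a<b\le r}\mathrm B\Big[\tfrac{\xi_{a,b-1}+\xi_{a+1,b}-\xi_{a+1,b-1}-\xi_{a,b}}{2};\tfrac{s_{a,b-1}+s_{a+1,b}-s_{a+1,b-1}-s_{a,b}}{2}\Big]\ \prod_{p=1}^r\prod_{v}\mathrm B\Big[\tfrac{\Delta_{A_v}-\Xi_{(v)}+\sum_m\Xi_{(v,m)}}{2};\tfrac{\Delta_{A_v}-s_{(v)}+\sum_m s_{(v,m)}}{2}\Big],$$ where $v$ runs over $A_p$ and all vertices of the trees attached to it, except that $v=A_p$ is omitted when $A_p$ is trivalent (i.e. carries only one propagator, bulk-to-bulk or bulk-to-boundary, besides those of the loop). \item \emph{Resulting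 formula.} The independent Mandelstam variables are $\Xi_a$ ($2\le a\le r$); $\xi_{a,b}$ ($1\le a\le b\le r$), except $\xi_{1,r}=2h$ and those $\xi_{a,a}$ for which $A_{(a)}$ is a single point (then $\xi_{a,a}$ is its dimension); and $\Xi_{(v)}$ for $v$ outside the loop, except when the parent of $v$ is a trivalent loop vertex $A_p$ (then $\Xi_{(v)}=\xi_{p,p}$). Let $\sharp$ be their number. For every function $M_0$ of these variables (in particular any original pre-amplitude, depending on the Mandelstam variables of the tree propagators only) such that the integral of $M_0K_{\rm pre}$ over all the $\tau_{ij}$ but one and all the $\tau_{k\,n+1}$ but one (whichever these are) converges absolutely, the function $M_0\,K_2^{\rm red}K_1^{\rm red}$ is integrable on the corresponding vertical contour and $$\int[d\tau]'_0\,M_0\,K_{\rm pre}=\frac1{2^{\sharp}}\int[d\Xi][d\xi]\;M_0[\Xi,\xi]\;K_2^{\rm red}[\Xi,\xi]\;K_1^{\rm red}[\Xi,\xi,s].$$ (The factor reads $(-2)^{-\sharp}$ if each Mandelstam contour is instead run downwards, from $+i\infty$ to $-i\infty$.) \end{enumerate} -/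

import Mathlib

open scoped BigOperators

noncomputable section

namespace WittenMellin

/-- Unordered pairs `{i, j}` of distinct boundary points among `n`, stored with `i < j`. -/
abbrev BPair (n : ℕ) : Type := {p : Fin n × Fin n // p.1 < p.2}

/-- The function `B[x; y] = Γ(x) Γ(y - x) / Γ(y)`. -/
def betaB (x y : ℂ) : ℂ := Complex.Gamma x * Complex.Gamma (y - x) / Complex.Gamma y

/-! ### Mellin integrals -/

section Contours

variable {J G : Type*} [Fintype J]

/-- The variables left free once one pivot variable has been selected in every group. -/
abbrev FreeVar (piv : G → J) : Type _ := {j : J // ∀ g, j ≠ piv g}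

open Classical in
/-- Displacement of all variables caused by a displacement `y` of the free ones, when the sum of
the variables in each group is kept fixed: the pivot of a group absorbs the displacement of the
other members of the group. -/
def shift (grp : G → Finset J) (piv : G → J) (y : FreeVar piv → ℝ) (j : J) : ℝ :=
  if hj : ∀ g, j ≠ piv g then y ⟨j, hj⟩
  else -∑ q : FreeVar piv, if ∃ g, piv g = j ∧ (q : J) ∈ grp g then y q else 0

/-- The point, over the parameter `y`, of the vertical contour through `z₀` in the affine space
on which the sum of the variables in each group is fixed. -/
def contourPoint (grp : G → Finset J) (piv : G → J) (z₀ : J → ℂ) (y : FreeVar piv → ℝ) : J → ℂ :=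
  fun j => z₀ j + Complex.I * (shift grp piv y j : ℂ)

open Classical in
/-- Absolute convergence of the Mellin integral `contourIntegral`. -/
def ContourIntegrable (grp : G → Finset J) (piv : G → J) (f : (J → ℂ) → ℂ) (z₀ : J → ℂ) : Prop :=
  MeasureTheory.Integrable (fun y : FreeVar piv → ℝ => f (contourPoint grp piv z₀ y))

open Classical in
/-- `∫ ∏ dz_j/(2πi) f(z)` over the free variables (one pivot per group being solved for from the
value of the group sum), each `z_j` running upwards along `Re z_j = Re (z₀)_j`. -/
def contourIntegral (grp : G → Finset J) (piv : G → J) (f : (J → ℂ) → ℂ) (z₀ : J → ℂ) : ℂ :=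
  (1 / (2 * Real.pi : ℂ)) ^ Fintype.card (FreeVar piv) *
    ∫ y : FreeVar piv → ℝ, f (contourPoint grp piv z₀ y)

end Contours

/-! ### Mellin variables and the loop formation kernel -/

section Kernel

variable {n : ℕ}

/-- `∑_{j ≠ k} τ_{jk}`, the sum running over the points `1, …, n` only. -/
def pairSumAt (τ : BPair n → ℂ) (k : Fin n) : ℂ :=
  ∑ p : BPair n, if p.1.1 = k ∨ p.1.2 = k then τ p else 0

/-- The canonical constraints on the Mellin variables of an `n`-point diagram. -/
def Canonical (Δ : Fin n → ℂ) (δ : BPair n → ℂ) : Prop :=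
  ∀ k, pairSumAt δ k = Δ k

/-- `τ_{0k}`, solved from `Δ_k = τ_{0k} + τ_{k,n+1} + ∑_{j ≠ k} τ_{jk}`; here `u k = τ_{k,n+1}`. -/
def tauZero (Δ : Fin n → ℂ) (τ : BPair n → ℂ) (u : Fin n → ℂ) (k : Fin n) : ℂ :=
  Δ k - u k - pairSumAt τ k

/-- The two remaining constraints on the Mellin variables `τ_{ij}`, `u k = τ_{k,n+1}` of the
original diagram (with `τ_{0,n+1} = 0`). -/
structure TauConstraints (Δ : Fin n → ℂ) (h : ℝ) (c : ℂ) (τ : BPair n → ℂ) (u : Fin n → ℂ) :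
    Prop where
  spectral : 2 * c = ∑ k, (u k - tauZero Δ τ u k)
  total : (∑ k, Δ k) / 2 - h = ∑ p, τ p

/-- The point `(τ, u)` lies in the region where the arguments of all the `Γ` functions in the
numerator of the kernel have positive real part, so that the vertical contour through it separates
their left poles from their right poles. -/
structure Separating (Δ : Fin n → ℂ) (δ : BPair n → ℂ) (τ : BPair n → ℂ) (u : Fin n → ℂ) :
    Prop where
  pair_pos : ∀ p, 0 < (τ p).re
  pair_lt : ∀ p, (τ p).re < (δ p).re
  last_pos : ∀ k, 0 < (u k).re
  zero_pos : ∀ k, 0 < (tauZero Δ τ u k).re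

/-- `K₁ = ∏_{i<j} Γ(τ_ij) Γ(δ_ij - τ_ij) / Γ(δ_ij)`. -/
def K₁pre (δ τ : BPair n → ℂ) : ℂ :=
  ∏ p, Complex.Gamma (τ p) * Complex.Gamma (δ p - τ p) / Complex.Gamma (δ p)

/-- `K₂ = ∏_k Γ(τ_{0k}) Γ(τ_{k,n+1}) / Γ(τ_{0k} + τ_{k,n+1})`. -/
def K₂pre (Δ : Fin n → ℂ) (τ : BPair n → ℂ) (u : Fin n → ℂ) : ℂ :=
  ∏ k, Complex.Gamma (tauZero Δ τ u k) * Complex.Gamma (u k) /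
    Complex.Gamma (tauZero Δ τ u k + u k)

/-- The Mandelstam variable `∑_{i ∈ S} Δ_i - 2 ∑_{i<j ∈ S} τ_ij` of a set of boundary points. -/
def mandelstam (Δ : Fin n → ℂ) (τ : BPair n → ℂ) (S : Finset (Fin n)) : ℂ :=
  ∑ k ∈ S, Δ k - 2 * ∑ p : BPair n, if p.1.1 ∈ S ∧ p.1.2 ∈ S then τ p else 0

end Kernel

/-! ### One-loop diagrams with trees attached to the loop -/

open Classical in
/-- A one-loop diagram with boundary points `Fin n` and bulk vertices `V`, whose loop is to be
closed by identifying two extra boundary points `0` and `n+1` attached to the two ends of a chain of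
`r` vertices `A_1, …, A_r`. The vertices without parent are those of the chain, and `pos` is their
place `1, …, r` on it. Every other vertex sits on a tree growing out of the chain, `parent` being
the next vertex towards the chain, and `pos` is the place of the chain vertex that carries its tree.
`leg k` is the bulk vertex to which the boundary point `k` is attached. -/
structure OneLoopDiagram (n r : ℕ) (V : Type*) [Fintype V] where
  pos : V → ℕ
  parent : V → Option V
  leg : Fin n → V
  wf : WellFounded fun w v : V => parent v = some w
  pos_bijOn : Set.BijOn pos {v | parent v = none} (Set.Icc 1 r)
  pos_parent : ∀ v w, parent v = some w → pos v = pos w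
  /-- Every bulk vertex is at least cubic. A chain vertex is incident to two propagators of the
  loop, any other vertex to one propagator leading to its parent. -/
  cubic : ∀ v, 3 ≤ (Finset.univ.filter fun w => parent w = some v).card +
    (Finset.univ.filter fun k => leg k = v).card + (if parent v = none then 2 else 1)

namespace OneLoopDiagram

variable {n r : ℕ} {V : Type*} [Fintype V] (D : OneLoopDiagram n r V)

open Classical in
/-- The vertices `A_{a,m}` that descend immediately from `v`. -/
def children (v : V) : Finset V := Finset.univ.filter fun w => D.parent w = some v

open Classical in
/-- The boundary points attached to `v` (the set `A_v`). -/
def legs (v : V) : Finset (Fin n) := Finset.univ.filter fun k => D.leg k = v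

/-- `v` is a vertex of the loop carrying a single further propagator, bulk-to-bulk or
bulk-to-boundary. -/
def TrivalentOnLoop (v : V) : Prop :=
  D.parent v = none ∧ (D.children v).card + (D.legs v).card = 1

/-- `w` is `v` or lies in the subtree growing out of `v`. -/
def InBranch (v w : V) : Prop :=
  Relation.ReflTransGen (fun x y => D.parent x = some y) w v

open Classical in
/-- The set `A_(v)` of boundary points in the subtree growing out of `v`. -/
def branchPts (v : V) : Finset (Fin n) := Finset.univ.filter fun k => D.InBranch v (D.leg k)

/-- The boundary points of the generalized vertices `A_(a), A_(a+1), …, A_(b)`. -/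
def segPts (a b : ℕ) : Finset (Fin n) :=
  Finset.univ.filter fun k => a ≤ D.pos (D.leg k) ∧ D.pos (D.leg k) ≤ b

/-! Mandelstam variables as functions of the Mellin variables. -/

/-- `Ξ_a`, for the propagator between `A_{a-1}` and `A_a` in the original diagram; this is
`h - c` for `a = 1` and `h + c` for `a = r + 1`. -/
def chainMand (Δ : Fin n → ℂ) (h : ℝ) (c : ℂ) (τ : BPair n → ℂ) (u : Fin n → ℂ) (a : ℕ) : ℂ :=
  h + c + mandelstam Δ τ (D.segPts a r) - 2 * ∑ k ∈ D.segPts a r, u k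

/-- `ξ_{a,b}` (or `s_{a,b}`, when applied to `δ`). -/
def loopMand (Δ : Fin n → ℂ) (τ : BPair n → ℂ) (a b : ℕ) : ℂ :=
  mandelstam Δ τ (D.segPts a b)

/-- `Ξ_(v)` (or `s_(v)`, when applied to `δ`). -/
def branchMand (Δ : Fin n → ℂ) (τ : BPair n → ℂ) (v : V) : ℂ :=
  mandelstam Δ τ (D.branchPts v)

/-! The reduced kernel. -/

/-- The reduced `K₂`, as a function of the values of the `Ξ_a` and of the `ξ_{a,b}`. -/
def K₂red (Ξ : ℕ → ℂ) (ξ : ℕ → ℕ → ℂ) : ℂ :=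
  ∏ a ∈ Finset.Icc 1 r,
    Complex.Gamma (((ξ a r - ξ (a + 1) r) - (Ξ a - Ξ (a + 1))) / 2) *
      Complex.Gamma (((Ξ a - Ξ (a + 1)) - (ξ 1 (a - 1) - ξ 1 a)) / 2) /
      Complex.Gamma (((ξ a r - ξ (a + 1) r) - (ξ 1 (a - 1) - ξ 1 a)) / 2)

/-- `(ξ_{a,b-1} + ξ_{a+1,b} - ξ_{a+1,b-1} - ξ_{a,b}) / 2`. -/
def crossArg (ξ : ℕ → ℕ → ℂ) (a b : ℕ) : ℂ :=
  (ξ a (b - 1) + ξ (a + 1) b - ξ (a + 1) (b - 1) - ξ a b) / 2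

/-- `(Δ_{A_v} - Ξ_(v) + ∑_m Ξ_(v,m)) / 2`. -/
def vertexArg (Δ : Fin n → ℂ) (Ξb : V → ℂ) (v : V) : ℂ :=
  (∑ k ∈ D.legs v, Δ k - Ξb v + ∑ w ∈ D.children v, Ξb w) / 2

open Classical in
/-- The reduced `K₁`, as a function of the values of the `ξ_{a,b}`, `Ξ_(v)`, `s_{a,b}`, `s_(v)`. -/
def K₁red (Δ : Fin n → ℂ) (ξ : ℕ → ℕ → ℂ) (Ξb : V → ℂ) (s : ℕ → ℕ → ℂ) (sb : V → ℂ) : ℂ :=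
  (∏ a ∈ Finset.Icc 1 r, ∏ b ∈ Finset.Icc (a + 1) r, betaB (crossArg ξ a b) (crossArg s a b)) *
    ∏ p ∈ Finset.Icc 1 r,
      ∏ v ∈ Finset.univ.filter (fun v => D.pos v = p ∧ ¬ D.TrivalentOnLoop v),
        betaB (D.vertexArg Δ Ξb v) (D.vertexArg Δ sb v)

/-! The groups of Mellin variables whose sums are fixed by the Mandelstam variables. -/

/-- Labels of the groups of variables `τ_ij`: a pair `a < b` of places on the loop, or a vertex that
is not a trivalent vertex of the loop. -/
abbrev PairGroup : Type _ :=
  {x : ℕ × ℕ // 1 ≤ x.1 ∧ x.1 < x.2 ∧ x.2 ≤ r} ⊕ {v : V // ¬ D.TrivalentOnLoop v}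

open Classical in
/-- The group labelled by `a < b` holds the `τ_ij` with one point in `A_(a)` and the other one in
`A_(b)`; the group labelled by `v` holds the `τ_ij` with both points in `A_(v)`, but not both in
the same subtree growing out of `v`. -/
def pairGroup : D.PairGroup → Finset (BPair n)
  | Sum.inl x => Finset.univ.filter fun p =>
      (D.pos (D.leg p.1.1) = x.1.1 ∧ D.pos (D.leg p.1.2) = x.1.2) ∨
        (D.pos (D.leg p.1.1) = x.1.2 ∧ D.pos (D.leg p.1.2) = x.1.1)
  | Sum.inr v => Finset.univ.filter fun p =>
      (p.1.1 ∈ D.branchPts v ∧ p.1.2 ∈ D.branchPts v) ∧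
        ∀ w ∈ D.children v, ¬ (p.1.1 ∈ D.branchPts w ∧ p.1.2 ∈ D.branchPts w)

/-- The group of the `τ_{k,n+1}` with `k` in `A_(a)`, for `a = 1, …, r`. -/
def lastGroup (a : {a : ℕ // 1 ≤ a ∧ a ≤ r}) : Finset (Fin n) := D.segPts a a

/-! The independent Mandelstam variables. -/

open Classical in
/-- The channels of the independent Mandelstam variables: `Ξ_a` with `2 ≤ a ≤ r`; `ξ_{a,b}` with
`1 ≤ a ≤ b ≤ r`, except `ξ_{1,r} = 2h` and those `ξ_{a,a}` that reduce to the dimension of the single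
boundary point of `A_(a)`; `Ξ_(v)` for the propagator from a vertex `v` outside the loop to its
parent, except where the parent is a trivalent vertex `A_p` of the loop, since then
`Ξ_(v) = ξ_{p,p}`. -/
def channels : Finset (ℕ ⊕ (ℕ × ℕ) ⊕ V) :=
  (Finset.Icc 2 r).disjSum
    (((Finset.Icc 1 r ×ˢ Finset.Icc 1 r).filter fun x =>
        x.1 ≤ x.2 ∧ x ≠ (1, r) ∧ 2 ≤ (D.segPts x.1 x.2).card).disjSum
      (Finset.univ.filter fun v => ∃ w, D.parent v = some w ∧ ¬ D.TrivalentOnLoop w))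

/-- The type of the channels of the independent Mandelstam variables. -/
abbrev Chan : Type _ := {x // x ∈ D.channels}

/-- The independent Mandelstam variables as functions of the Mellin variables. -/
def indep (Δ : Fin n → ℂ) (h : ℝ) (c : ℂ) (τ : BPair n → ℂ) (u : Fin n → ℂ) (x : D.Chan) : ℂ :=
  match x.1 with
  | Sum.inl a => D.chainMand Δ h c τ u a
  | Sum.inr (Sum.inl y) => D.loopMand Δ τ y.1 y.2
  | Sum.inr (Sum.inr v) => D.branchMand Δ τ v

open Classical in
/-- All the `Ξ_a`, `1 ≤ a ≤ r + 1`, from the values of the independent variables. -/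
def chainOf (h : ℝ) (c : ℂ) (z : D.Chan → ℂ) (a : ℕ) : ℂ :=
  if ha : Sum.inl a ∈ D.channels then z ⟨_, ha⟩ else if a = 1 then h - c else h + c

open Classical in
/-- All the `ξ_{a,b}` from the values of the independent variables; `ξ_{a,b} = 0` for `a > b`. -/
def loopOf (Δ : Fin n → ℂ) (h : ℝ) (z : D.Chan → ℂ) (a b : ℕ) : ℂ :=
  if hab : Sum.inr (Sum.inl (a, b)) ∈ D.channels then z ⟨_, hab⟩
  else if a = 1 ∧ b = r then 2 * h else ∑ k ∈ D.segPts a b, Δ k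

open Classical in
/-- All the `Ξ_(v)` from the values of the independent variables, with `Ξ_(p) = ξ_{p,p}`. -/
def branchOf (Δ : Fin n → ℂ) (h : ℝ) (z : D.Chan → ℂ) (v : V) : ℂ :=
  if hv : Sum.inr (Sum.inr v) ∈ D.channels then z ⟨_, hv⟩
  else D.loopOf Δ h z (D.pos v) (D.pos v)

/-- The reduced kernel `K = K₂ K₁`, as a function of the independent Mandelstam variables `z` of the
original diagram and of the Mandelstam variables of the new diagram. -/
def Kred (Δ : Fin n → ℂ) (h : ℝ) (c : ℂ) (δ : BPair n → ℂ) (z : D.Chan → ℂ) : ℂ :=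
  K₂red (r := r) (D.chainOf h c z) (D.loopOf Δ h z) *
    D.K₁red Δ (D.loopOf Δ h z) (D.branchOf Δ h z) (D.loopMand Δ δ) (D.branchMand Δ δ)

/-! The pre-amplitude. -/

/-- The integrand `M₀ K_pre` of the loop formation formula, over a parameter `y` of the contour
through `(τ₀, u₀)`: the independent variables are all the `τ_ij` but `τ_{p₀}` and all the `τ_{k,n+1}`
but that of `k₀`. The original pre-amplitude `M₀` depends on Mandelstam variables only. -/
def preIntegrand (Δ : Fin n → ℂ) (h : ℝ) (c : ℂ) (δ : BPair n → ℂ) (M₀ : (D.Chan → ℂ) → ℂ)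
    (p₀ : BPair n) (k₀ : Fin n) (τ₀ : BPair n → ℂ) (u₀ : Fin n → ℂ)
    (y : (FreeVar (fun _ : Unit => p₀) → ℝ) × (FreeVar (fun _ : Unit => k₀) → ℝ)) : ℂ :=
  let τ := contourPoint (fun _ : Unit => Finset.univ) (fun _ => p₀) τ₀ y.1
  let u := contourPoint (fun _ : Unit => Finset.univ) (fun _ => k₀) u₀ y.2
  M₀ (D.indep Δ h c τ u) * (K₂pre Δ τ u * K₁pre δ τ)

/-- The pre-amplitude `M[δ] = ∫ [dτ]'₀ M₀[τ] K_pre[τ, δ]` of the diagram obtained by forming the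
loop. -/
def preAmplitude (Δ : Fin n → ℂ) (h : ℝ) (c : ℂ) (δ : BPair n → ℂ) (M₀ : (D.Chan → ℂ) → ℂ)
    (p₀ : BPair n) (k₀ : Fin n) (τ₀ : BPair n → ℂ) (u₀ : Fin n → ℂ) : ℂ :=
  (1 / (2 * Real.pi : ℂ)) ^ (Fintype.card (FreeVar (fun _ : Unit => p₀)) +
      Fintype.card (FreeVar (fun _ : Unit => k₀))) *
    ∫ y, D.preIntegrand Δ h c δ M₀ p₀ k₀ τ₀ u₀ y

/-- The integrand `M₀ K` of the reduced formula, over a parameter `t` of the vertical contour through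
the values of the Mandelstam variables at `(τ₀, u₀)`. -/
def redIntegrand (Δ : Fin n → ℂ) (h : ℝ) (c : ℂ) (δ : BPair n → ℂ) (M₀ : (D.Chan → ℂ) → ℂ)
    (τ₀ : BPair n → ℂ) (u₀ : Fin n → ℂ) (t : D.Chan → ℝ) : ℂ :=
  let z : D.Chan → ℂ := fun x => D.indep Δ h c τ₀ u₀ x + Complex.I * (t x : ℂ)
  M₀ z * D.Kred Δ h c δ z

/-- `∫ [dΞ] [dξ] M₀[Ξ, ξ] K[Ξ, ξ, s]`, each of the independent Mandelstam variables being integrated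
upwards along a vertical line with the measure `dz/(2πi)`. -/
def redIntegral (Δ : Fin n → ℂ) (h : ℝ) (c : ℂ) (δ : BPair n → ℂ) (M₀ : (D.Chan → ℂ) → ℂ)
    (τ₀ : BPair n → ℂ) (u₀ : Fin n → ℂ) : ℂ :=
  (1 / (2 * Real.pi : ℂ)) ^ Fintype.card D.Chan *
    ∫ t : D.Chan → ℝ, D.redIntegrand Δ h c δ M₀ τ₀ u₀ t

end OneLoopDiagram

end WittenMellin

end

open WittenMellin

namespace WittenMellin

open MeasureTheory Set Filter Topology Asymptotics

/-! ### The beta function on vertical lines -/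

/-! Every factor of the kernel is a beta function `betaB x y` on a vertical line in `x` with `y`
fixed; for `K₂pre` this is because `τ_{0k} + τ_{k,n+1}` does not involve the `τ_{k,n+1}`. As a
function of `x` it is the Mellin transform of `(1 + t)^(-y)`. Multiplying two such functions of `t`
adds the exponents, so on the Mellin side the convolution of `betaB · y` and `betaB · y'` is `betaB
· (y + y')` (`integral_betaB_mul_betaB`). Integrating out the free variables of a group one at a
time merges each into the pivot. A product of beta functions whose variables have fixed group sums
therefore integrates to one beta function per group, evaluated at the group sums
(`contourIntegral_prod_betaB`).

What remains of the first two claims is combinatorics. Each pair of points lies in exactly one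
group: if the points hang from different loop vertices, that of their two places; otherwise that of
the lowest vertex whose branch contains both (`existsUnique_mem_pairGroup`). Inclusion-exclusion
writes the group sums as differences of Mandelstam variables, and these differences are the
arguments of the reduced kernel.

For the pre-amplitude, imaginary displacements of the Mellin variables are replaced by the channel
coordinates together with the variables free inside the groups (`mandelstamEquiv`). This linear map
and its inverse both preserve integer vectors, so it has determinant `±1` after identification of
the index sets and preserves volume. Fubini then applies: on a fibre `M₀` is constant and the first
two claims evaluate the rest. A Mandelstam variable moves by `-2` times its coordinate, and
rescaling gives one factor `1/2` per channel (`integral_eq_of_fibre`). -/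

theorem norm_Gamma_le_Gamma_re {z : ℂ} (hz : 0 < z.re) : ‖Complex.Gamma z‖ ≤ Real.Gamma z.re := by
  rw [Complex.Gamma_eq_integral hz, Real.Gamma_eq_integral hz, Complex.GammaIntegral]
  refine (norm_integral_le_integral_norm _).trans (le_of_eq ?_)
  refine setIntegral_congr_fun measurableSet_Ioi fun x hx => ?_
  have hx : 0 < x := hx
  simp only [norm_mul, Complex.norm_cpow_eq_rpow_re_of_pos hx, Complex.norm_real, Real.norm_eq_abs,
    abs_of_pos (Real.exp_pos _), Complex.sub_re, Complex.one_re]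

theorem re_add_I_mul_ofReal (z : ℂ) (t : ℝ) : (z + Complex.I * t).re = z.re := by simp

theorem continuousAt_Gamma_of_re_pos {z : ℂ} (hz : 0 < z.re) : ContinuousAt Complex.Gamma z := by
  refine (Complex.differentiableAt_Gamma z fun m h => ?_).continuousAt
  have := congrArg Complex.re h
  simp only [Complex.neg_re, Complex.natCast_re] at this
  have : (0 : ℝ) ≤ m := m.cast_nonneg
  linarith

/-- The vertical strip on which the arguments of both Gamma functions in the numerator of `B[x; y]`
have positive real part. -/
def InStrip (x y : ℂ) : Prop := 0 < x.re ∧ x.re < y.re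

namespace InStrip

variable {x y x' y' : ℂ}

theorem add (hx : InStrip x y) (hx' : InStrip x' y') : InStrip (x + x') (y + y') := by
  obtain ⟨h₁, h₂⟩ := hx
  obtain ⟨h₃, h₄⟩ := hx'
  constructor <;> simp only [Complex.add_re] <;> linarith

theorem congr_re (hx : InStrip x y) (hre : x'.re = x.re) : InStrip x' y := by
  rwa [InStrip, hre]

theorem add_I_mul (hx : InStrip x y) (t : ℝ) : InStrip (x + Complex.I * t) y :=
  hx.congr_re (re_add_I_mul_ofReal x t)

theorem sub_re_pos (hx : InStrip x y) : 0 < (y - x).re := by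
  simpa using hx.2

end InStrip

theorem continuousAt_betaB {x y : ℂ} (h : InStrip x y) : ContinuousAt (fun x => betaB x y) x := by
  unfold betaB
  refine ((continuousAt_Gamma_of_re_pos h.1).mul ?_).div_const _
  exact (ContinuousAt.comp (f := fun x => y - x) (continuousAt_Gamma_of_re_pos h.sub_re_pos)
    (by fun_prop))

theorem continuous_betaB_comp {X : Type*} [TopologicalSpace X] {f : X → ℂ} {y : ℂ}
    (hf : Continuous f) (h : ∀ t, InStrip (f t) y) : Continuous fun t => betaB (f t) y :=
  continuous_iff_continuousAt.2 fun t =>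
    ContinuousAt.comp (f := f) (continuousAt_betaB (h t)) hf.continuousAt

theorem norm_betaB_le {x y : ℂ} (h : InStrip x y) :
    ‖betaB x y‖ ≤ Real.Gamma x.re * Real.Gamma (y.re - x.re) / ‖Complex.Gamma y‖ := by
  rw [betaB, norm_div, norm_mul]
  gcongr
  · exact Real.Gamma_nonneg_of_nonneg h.1.le
  · exact norm_Gamma_le_Gamma_re h.1
  · simpa using norm_Gamma_le_Gamma_re h.sub_re_pos

theorem norm_betaB_add_I_mul_le {x y : ℂ} (h : InStrip x y) (t : ℝ) :
    ‖betaB (x + Complex.I * t) y‖ ≤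
      Real.Gamma x.re * Real.Gamma (y.re - x.re) / ‖Complex.Gamma y‖ := by
  simpa using norm_betaB_le (h.add_I_mul t)

/-- The recursion `Γ(z + 1) = z Γ(z)`, applied to both numerator factors, extracts `1 / (x (y -
x))`. This decays quadratically along a vertical line while the shifted beta function stays bounded,
so no Stirling estimate is needed for integrability. -/
theorem betaB_eq_betaB_add_one {x y : ℂ} (h : InStrip x y) :
    betaB x y = Complex.Gamma (y + 2) / Complex.Gamma y * betaB (x + 1) (y + 2) *
      (1 / x) * (1 / (y - x)) := by
  have hx : x ≠ 0 := fun h0 => by simpa [h0] using h.1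
  have hyx : y - x ≠ 0 := fun h0 => by simpa [h0] using h.sub_re_pos
  have hy : Complex.Gamma (y + 2) ≠ 0 := by
    refine Complex.Gamma_ne_zero_of_re_pos ?_
    have := h.1.trans h.2
    simp only [Complex.add_re, Complex.re_ofNat]
    linarith
  have h1 := Complex.Gamma_add_one x hx
  have h2 := Complex.Gamma_add_one (y - x) hyx
  rw [betaB, betaB, h1, show y + 2 - (x + 1) = y - x + 1 by ring, h2]
  field_simp

theorem integrable_one_div_norm_sq {x : ℂ} (hx : x.re ≠ 0) :
    Integrable fun t : ℝ => (1 / ‖x + Complex.I * t‖) ^ 2 := by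
  -- With `a = Re x` and `b = Im x`, `|x + it|⁻² = a⁻² / (1 + ((t + b)/a)²)`.
  have h := ((integrable_inv_one_add_sq.comp_div hx).comp_add_right x.im).const_mul (x.re ^ 2)⁻¹
  refine h.congr (Eventually.of_forall fun t => ?_)
  simp only
  rw [div_pow, div_pow, one_pow, ← Complex.normSq_eq_norm_sq, Complex.normSq_apply]
  simp only [Complex.add_re, Complex.mul_re, Complex.I_re, Complex.ofReal_re, Complex.I_im,
    Complex.ofReal_im, Complex.add_im, Complex.mul_im]
  rw [← mul_inv, one_div]
  congr 1
  field_simp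
  ring

theorem integrable_betaB {x y : ℂ} (h : InStrip x y) :
    Integrable fun t : ℝ => betaB (x + Complex.I * t) y := by
  have hs : InStrip (x + 1) (y + 2) := by
    obtain ⟨h₁, h₂⟩ := h
    constructor <;> simp <;> linarith
  set C := ‖Complex.Gamma (y + 2) / Complex.Gamma y‖ *
    (Real.Gamma (x + 1).re * Real.Gamma ((y + 2).re - (x + 1).re) / ‖Complex.Gamma (y + 2)‖) with hC
  have hC0 : 0 ≤ C :=
    mul_nonneg (norm_nonneg _) ((norm_nonneg _).trans (norm_betaB_le hs))
  have h1 := integrable_one_div_norm_sq h.1.ne'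
  have h2 := (integrable_one_div_norm_sq h.sub_re_pos.ne').comp_neg
  refine ((h1.add h2).const_mul C).mono'
    (continuous_betaB_comp (by fun_prop) h.add_I_mul).aestronglyMeasurable
    (Eventually.of_forall fun t => ?_)
  rw [betaB_eq_betaB_add_one (h.add_I_mul t), mul_assoc, norm_mul, norm_mul, norm_mul]
  have e1 : ‖betaB (x + Complex.I * t + 1) (y + 2)‖ ≤
      Real.Gamma (x + 1).re * Real.Gamma ((y + 2).re - (x + 1).re) / ‖Complex.Gamma (y + 2)‖ := by
    rw [show x + Complex.I * t + 1 = x + 1 + Complex.I * t by ring]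
    exact norm_betaB_add_I_mul_le hs t
  have e2 : y - (x + Complex.I * t) = y - x + Complex.I * ((-t : ℝ) : ℂ) := by push_cast; ring
  rw [e2]
  simp only [Pi.add_apply, norm_div, norm_one]
  set a := 1 / ‖x + Complex.I * (t : ℂ)‖
  set b := 1 / ‖y - x + Complex.I * ((-t : ℝ) : ℂ)‖
  -- Dominating the product by squares separates the two linear factors, each of which is then
  -- square integrable on its own.
  have hab : a * b ≤ a ^ 2 + b ^ 2 := by nlinarith [sq_nonneg (a - b), sq_nonneg a, sq_nonneg b]
  have ha : 0 ≤ a := by positivity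
  have hb : 0 ≤ b := by positivity
  refine mul_le_mul ?_ hab (mul_nonneg ha hb) hC0
  rw [hC, norm_div]
  gcongr

/-! ### The Mellin transform of `(1 + t)^(-y)` and its inversion -/

theorem slitPlane_one_add {x : ℝ} (hx : 0 < x) : (1 + x : ℂ) ∈ Complex.slitPlane := by
  left; simp; linarith

theorem norm_one_add_cpow {x : ℝ} (hx : 0 < x) (y : ℂ) : ‖(1 + x : ℂ) ^ y‖ = (1 + x) ^ y.re := by
  simpa using Complex.norm_cpow_eq_rpow_re_of_pos (x := 1 + x) (by linarith) y

theorem continuousOn_one_add_cpow (y : ℂ) : ContinuousOn (fun x : ℝ => (1 + x : ℂ) ^ y) (Ioi 0) :=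
  ContinuousOn.cpow (by fun_prop) (by fun_prop) fun _ hx => slitPlane_one_add hx

theorem continuousOn_ofReal_cpow (y : ℂ) : ContinuousOn (fun x : ℝ => (x : ℂ) ^ y) (Ioi 0) :=
  ContinuousOn.cpow (by fun_prop) (by fun_prop) fun x hx => Or.inl (by simpa using hx)

/-- The modulus is at most `t^(-Re y)` at infinity and at most `1` near zero, so the strip `0 < Re x
< Re y` gives convergence at both ends. -/
theorem mellinConvergent_one_add_cpow {x y : ℂ} (h : InStrip x y) :
    MellinConvergent (fun t : ℝ => (1 + t : ℂ) ^ (-y)) x := by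
  have hy := h.1.trans h.2
  refine mellinConvergent_of_isBigO_rpow (a := y.re) (b := 0)
    ((continuousOn_one_add_cpow _).locallyIntegrableOn measurableSet_Ioi) ?_ h.2 ?_ h.1
  · refine IsBigO.of_bound 1 ?_
    filter_upwards [eventually_gt_atTop 0] with t ht
    rw [norm_one_add_cpow ht, one_mul, Real.norm_of_nonneg (by positivity), Complex.neg_re]
    exact Real.rpow_le_rpow_of_nonpos ht (by linarith) (by linarith)
  · refine IsBigO.of_bound 1 ?_
    filter_upwards [self_mem_nhdsWithin] with t ht
    have ht : 0 < t := ht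
    rw [norm_one_add_cpow ht, one_mul, neg_zero, Real.rpow_zero, norm_one, Complex.neg_re]
    exact Real.rpow_le_one_of_one_le_of_nonpos (by linarith) (by linarith)

theorem integrableOn_rpow_mul_exp_neg_mul {a r : ℝ} (ha : 0 < a) (hr : 0 < r) :
    IntegrableOn (fun s : ℝ => s ^ (a - 1) * Real.exp (-(r * s))) (Ioi 0) := by
  simpa using integrableOn_rpow_mul_exp_neg_mul_rpow (s := a - 1) (p := 1) (b := r)
    (by linarith) zero_lt_one hr

/-- Justifies the exchange of integrals when `Γ(y) (1 + t)^(-y)` is written as the integral of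
`s^(y-1) exp(-(1+t)s)` inside the Mellin transform. Integrating the modulus over `s` first leaves
the convergent Mellin integral of the previous estimate. -/
theorem integrable_betaKernel {x y : ℂ} (h : InStrip x y) :
    Integrable (fun p : ℝ × ℝ => (p.1 : ℂ) ^ (x - 1) *
        ((p.2 : ℂ) ^ (y - 1) * Complex.exp (-((1 + p.1 : ℝ) * p.2))))
      ((volume.restrict (Ioi 0)).prod (volume.restrict (Ioi 0))) := by
  have hy := h.1.trans h.2
  have hmeas : AEStronglyMeasurable (fun p : ℝ × ℝ => (p.1 : ℂ) ^ (x - 1) *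
      ((p.2 : ℂ) ^ (y - 1) * Complex.exp (-((1 + p.1 : ℝ) * p.2))))
      ((volume.restrict (Ioi 0)).prod (volume.restrict (Ioi 0))) := by
    rw [Measure.prod_restrict]
    refine ContinuousOn.aestronglyMeasurable ?_ (measurableSet_Ioi.prod measurableSet_Ioi)
    refine ContinuousOn.mul ((continuousOn_ofReal_cpow _).comp continuousOn_fst fun p hp => hp.1)
      (ContinuousOn.mul ((continuousOn_ofReal_cpow _).comp continuousOn_snd fun p hp => hp.2) ?_)
    fun_prop
  have hnorm : ∀ t ∈ Ioi (0 : ℝ), ∀ s ∈ Ioi (0 : ℝ),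
      ‖(t : ℂ) ^ (x - 1) * ((s : ℂ) ^ (y - 1) * Complex.exp (-((1 + t : ℝ) * s)))‖ =
        t ^ (x.re - 1) * (s ^ (y.re - 1) * Real.exp (-((1 + t) * s))) := by
    intro t ht s hs
    rw [norm_mul, norm_mul, Complex.norm_cpow_eq_rpow_re_of_pos ht,
      Complex.norm_cpow_eq_rpow_re_of_pos hs, Complex.norm_exp]
    simp
  rw [integrable_prod_iff hmeas]
  constructor
  · filter_upwards [ae_restrict_mem measurableSet_Ioi] with t ht
    have ht' : 0 < t := ht
    refine (((integrableOn_rpow_mul_exp_neg_mul hy (r := 1 + t) (by linarith)).const_mul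
      (t ^ (x.re - 1))).mono' ?_ ?_)
    · refine ContinuousOn.aestronglyMeasurable ?_ measurableSet_Ioi
      exact continuousOn_const.mul ((continuousOn_ofReal_cpow _).mul (by fun_prop))
    · filter_upwards [ae_restrict_mem measurableSet_Ioi] with s hs
      exact (hnorm t ht s hs).le
  · have hm : IntegrableOn (fun t : ℝ => t ^ (x.re - 1) * ((1 + t) ^ (-y.re))) (Ioi 0) := by
      refine IntegrableOn.congr_fun (mellinConvergent_one_add_cpow h).norm (fun t ht => ?_)
        measurableSet_Ioi
      simp only [smul_eq_mul, norm_mul, Complex.norm_cpow_eq_rpow_re_of_pos ht,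
        norm_one_add_cpow ht, Complex.sub_re, Complex.one_re, Complex.neg_re]
    refine IntegrableOn.congr_fun (hm.mul_const (Real.Gamma y.re)) (fun t ht => ?_)
      measurableSet_Ioi
    have ht' : 0 < t := ht
    simp only
    rw [setIntegral_congr_fun measurableSet_Ioi (hnorm t ht), integral_const_mul,
      Real.integral_rpow_mul_exp_neg_mul_Ioi hy (by linarith), one_div,
      Real.inv_rpow (by linarith), Real.rpow_neg (by linarith), mul_assoc]

/-- `B[x; y]` as a Mellin transform. -/
theorem mellin_one_add_cpow {x y : ℂ} (h : InStrip x y) :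
    mellin (fun t : ℝ => (1 + t : ℂ) ^ (-y)) x = betaB x y := by
  have hy : 0 < y.re := h.1.trans h.2
  have hΓ : Complex.Gamma y ≠ 0 := Complex.Gamma_ne_zero_of_re_pos hy
  have hswap := integral_integral_swap (f := fun t s : ℝ => (t : ℂ) ^ (x - 1) *
    ((s : ℂ) ^ (y - 1) * Complex.exp (-((1 + t : ℝ) * s)))) (integrable_betaKernel h)
  rw [betaB, eq_div_iff hΓ, mellin, ← integral_mul_const]
  have e1 : ∀ t ∈ Ioi (0 : ℝ), (t : ℂ) ^ (x - 1) • (1 + t : ℂ) ^ (-y) * Complex.Gamma y =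
      ∫ s : ℝ in Ioi 0, (t : ℂ) ^ (x - 1) *
        ((s : ℂ) ^ (y - 1) * Complex.exp (-((1 + t : ℝ) * s))) := by
    intro t ht
    have ht' : 0 < t := ht
    rw [integral_const_mul, Complex.integral_cpow_mul_exp_neg_mul_Ioi hy (r := 1 + t) (by linarith),
      smul_eq_mul, mul_assoc, one_div, Complex.inv_cpow, Complex.cpow_neg]
    · push_cast; rfl
    · rw [Complex.arg_ofReal_of_nonneg (by linarith)]; exact Real.pi_pos.ne
  have e2 : ∀ s ∈ Ioi (0 : ℝ), (∫ t : ℝ in Ioi 0, (t : ℂ) ^ (x - 1) *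
        ((s : ℂ) ^ (y - 1) * Complex.exp (-((1 + t : ℝ) * s)))) =
      (s : ℂ) ^ (y - x - 1) * Complex.exp (-((1 : ℝ) * s)) * Complex.Gamma x := by
    intro s hs
    have hs' : 0 < s := hs
    have hs0 : (s : ℂ) ≠ 0 := by exact_mod_cast hs'.ne'
    have e3 : ∀ t ∈ Ioi (0 : ℝ), (t : ℂ) ^ (x - 1) *
        ((s : ℂ) ^ (y - 1) * Complex.exp (-((1 + t : ℝ) * s))) =
        (s : ℂ) ^ (y - 1) * Complex.exp (-((1 : ℝ) * s)) *
          ((t : ℂ) ^ (x - 1) * Complex.exp (-(s * t))) := by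
      intro t _
      rw [show -(((1 + t : ℝ) : ℂ) * s) = -((1 : ℝ) * s) + -(s * t) by push_cast; ring,
        Complex.exp_add]
      ring
    rw [setIntegral_congr_fun measurableSet_Ioi e3, integral_const_mul,
      Complex.integral_cpow_mul_exp_neg_mul_Ioi h.1 hs', one_div, Complex.inv_cpow,
      ← Complex.cpow_neg, show y - x - 1 = y - 1 + -x by ring, Complex.cpow_add _ _ hs0]
    · ring
    · rw [Complex.arg_ofReal_of_nonneg hs'.le]; exact Real.pi_pos.ne
  rw [setIntegral_congr_fun measurableSet_Ioi e1]
  refine hswap.trans ?_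
  rw [setIntegral_congr_fun measurableSet_Ioi e2, integral_mul_const,
    Complex.integral_cpow_mul_exp_neg_mul_Ioi h.sub_re_pos one_pos]
  simp [mul_comm]

theorem integral_cpow_mul_betaB {x y : ℂ} (h : InStrip x y) {t : ℝ} (ht : 0 < t) :
    ∫ u : ℝ, (t : ℂ) ^ (-(x + Complex.I * u)) * betaB (x + Complex.I * u) y =
      2 * Real.pi * (1 + t : ℂ) ^ (-y) := by
  have hre : InStrip (x.re : ℂ) y := h.congr_re (by simp)
  have hline : ∀ u : ℝ, mellin (fun t : ℝ => (1 + t : ℂ) ^ (-y)) (x.re + u * Complex.I) =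
      betaB (x.re + Complex.I * u) y := by
    intro u
    rw [mul_comm (u : ℂ)]
    exact mellin_one_add_cpow (hre.add_I_mul u)
  have hinv := mellinInv_mellin_eq x.re (fun t : ℝ => (1 + t : ℂ) ^ (-y)) ht
    (mellinConvergent_one_add_cpow hre) (by
      simp only [Complex.VerticalIntegrable, hline]
      exact integrable_betaB hre)
    ((continuousOn_one_add_cpow (-y)).continuousAt (Ioi_mem_nhds ht))
  rw [mellinInv] at hinv
  simp only [hline, smul_eq_mul, Complex.real_smul] at hinv
  rw [← hinv]
  -- Mellin inversion is parametrised from the real point `Re x`; translating `u` by `Im x` starts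
  -- the same line at `x`.
  have hshift := integral_add_right_eq_self (μ := volume)
    (fun u : ℝ => (t : ℂ) ^ (-(x.re + u * Complex.I)) * betaB (x.re + Complex.I * u) y) x.im
  have hx : ∀ u : ℝ, x + Complex.I * u = x.re + Complex.I * ((u + x.im : ℝ) : ℂ) := by
    intro u
    conv_lhs => rw [← Complex.re_add_im x]
    push_cast; ring
  rw [← hshift]
  simp only [hx, mul_comm _ Complex.I]
  have : (Real.pi : ℂ) ≠ 0 := by exact_mod_cast Real.pi_ne_zero
  push_cast
  field_simp

/-- The convolution formula for the beta function along vertical lines, a form of Barnes' first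
lemma. -/
theorem integral_betaB_mul_betaB {x y x' y' : ℂ} (h : InStrip x y) (h' : InStrip x' y') :
    ∫ u : ℝ, betaB (x + Complex.I * u) y * betaB (x' - Complex.I * u) y' =
      2 * Real.pi * betaB (x + x') (y + y') := by
  have hu : ∀ u : ℝ, InStrip (x' - Complex.I * u) y' := fun u => h'.congr_re (by simp)
  have hint : Integrable (fun p : ℝ × ℝ => betaB (x + Complex.I * p.1) y *
      ((p.2 : ℂ) ^ (x' - Complex.I * p.1 - 1) * (1 + p.2 : ℂ) ^ (-y')))
      (volume.prod (volume.restrict (Ioi 0))) := by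
    have hprod : Integrable (fun p : ℝ × ℝ => betaB (x + Complex.I * p.1) y *
        ((p.2 : ℂ) ^ (x' - 1) • (1 + p.2 : ℂ) ^ (-y')))
        (volume.prod (volume.restrict (Ioi 0))) :=
      (integrable_betaB h).mul_prod (mellinConvergent_one_add_cpow h')
    have hpos : ∀ᵐ p : ℝ × ℝ ∂volume.prod (volume.restrict (Ioi 0)), 0 < p.2 :=
      Measure.quasiMeasurePreserving_snd.ae (ae_restrict_mem measurableSet_Ioi)
    refine hprod.mono ?_ ?_
    · have : (volume : Measure ℝ).prod (volume.restrict (Ioi (0 : ℝ))) =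
          ((volume : Measure ℝ).prod volume).restrict (univ ×ˢ Ioi 0) := by
        rw [← Measure.prod_restrict, Measure.restrict_univ]
      rw [this]
      refine ContinuousOn.aestronglyMeasurable ?_ (MeasurableSet.univ.prod measurableSet_Ioi)
      refine ContinuousOn.mul ?_ (ContinuousOn.mul ?_ ?_)
      · exact ((continuous_betaB_comp (f := fun u : ℝ => x + Complex.I * u)
          (by fun_prop) h.add_I_mul).comp continuous_fst).continuousOn
      · refine ContinuousOn.cpow (by fun_prop) (by fun_prop) fun p hp => Or.inl ?_
        simpa using hp.2
      · exact (continuousOn_one_add_cpow _).comp continuousOn_snd fun p hp => hp.2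
    · filter_upwards [hpos] with p hp
      simp only [norm_mul, smul_eq_mul, Complex.norm_cpow_eq_rpow_re_of_pos hp]
      simp
  have hswap := integral_integral_swap (f := fun u t : ℝ => betaB (x + Complex.I * u) y *
      ((t : ℂ) ^ (x' - Complex.I * u - 1) * (1 + t : ℂ) ^ (-y'))) hint
  -- The second factor is opened as a Mellin transform. After the exchange, the `u`-integral is the
  -- Mellin inversion of the first factor, and the two powers of `1 + t` combine into the kernel for
  -- `y + y'`.
  calc ∫ u : ℝ, betaB (x + Complex.I * u) y * betaB (x' - Complex.I * u) y'
      = ∫ u : ℝ, ∫ t : ℝ in Ioi 0, betaB (x + Complex.I * u) y *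
          ((t : ℂ) ^ (x' - Complex.I * u - 1) * (1 + t : ℂ) ^ (-y')) := by
        refine integral_congr_ae (Eventually.of_forall fun u => ?_)
        simp only [integral_const_mul]
        rw [← mellin_one_add_cpow (hu u), mellin]
        simp only [smul_eq_mul]
    _ = ∫ t : ℝ in Ioi 0, ∫ u : ℝ, betaB (x + Complex.I * u) y *
          ((t : ℂ) ^ (x' - Complex.I * u - 1) * (1 + t : ℂ) ^ (-y')) := hswap
    _ = ∫ t : ℝ in Ioi 0, 2 * Real.pi *
          ((t : ℂ) ^ (x + x' - 1) • (1 + t : ℂ) ^ (-(y + y'))) := by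
        refine setIntegral_congr_fun measurableSet_Ioi fun t ht => ?_
        have ht' : 0 < t := ht
        have ht0 : (t : ℂ) ≠ 0 := by exact_mod_cast ht'.ne'
        have ht1 : (1 + t : ℂ) ≠ 0 := Complex.slitPlane_ne_zero (slitPlane_one_add ht')
        simp only [smul_eq_mul]
        have e : ∀ u : ℝ, betaB (x + Complex.I * u) y *
            ((t : ℂ) ^ (x' - Complex.I * u - 1) * (1 + t : ℂ) ^ (-y')) =
            (t : ℂ) ^ (x + x' - 1) * (1 + t : ℂ) ^ (-y') *
              ((t : ℂ) ^ (-(x + Complex.I * u)) * betaB (x + Complex.I * u) y) := by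
          intro u
          rw [show x' - Complex.I * u - 1 = (x + x' - 1) + -(x + Complex.I * u) by ring,
            Complex.cpow_add _ _ ht0]
          ring
        simp only [e]
        rw [integral_const_mul, integral_cpow_mul_betaB h ht', neg_add, Complex.cpow_add _ _ ht1]
        ring
    _ = 2 * Real.pi * betaB (x + x') (y + y') := by
        rw [integral_const_mul, ← mellin_one_add_cpow (h.add h'), mellin]

/-! ### Products of beta functions with fixed sums of the arguments -/

theorem ofReal_sum_ite {F : Type*} [Fintype F] (p : F → Prop) [DecidablePred p] (t : F → ℝ) :
    ((∑ j, if p j then t j else 0 : ℝ) : ℂ) = ∑ j, if p j then (t j : ℂ) else 0 := by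
  rw [Complex.ofReal_sum]
  exact Finset.sum_congr rfl fun j _ => by split_ifs <;> simp

section Star

variable {F P : Type*} [Fintype F] [DecidableEq P]

/-- A product of beta functions over leaves `j : F` and hubs `p : P`, the leaves moving freely along
vertical lines while each hub moves so as to keep its sum with its leaves fixed. -/
noncomputable def starIntegrand [Fintype P] (π : F → P) (z y : F → ℂ) (x w : P → ℂ) (t : F → ℝ) : ℂ :=
  (∏ j, betaB (z j + Complex.I * t j) (y j)) *
    ∏ p, betaB (x p - Complex.I * ∑ j, if π j = p then (t j : ℂ) else 0) (w p)

theorem inStrip_hub {x w : P → ℂ} (hx : ∀ p, InStrip (x p) (w p)) (π : F → P) (t : F → ℝ) (p : P) :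
    InStrip (x p - Complex.I * ∑ j, if π j = p then (t j : ℂ) else 0) (w p) := by
  rw [← ofReal_sum_ite]
  exact (hx p).congr_re (by simp)

variable [Fintype P]

/-- The leaves vary independently and each is integrable; the hubs are merely bounded on their
vertical lines. -/
theorem integrable_starIntegrand (π : F → P) {z y : F → ℂ} {x w : P → ℂ}
    (hz : ∀ j, InStrip (z j) (y j)) (hx : ∀ p, InStrip (x p) (w p)) :
    Integrable (starIntegrand π z y x w) := by
  have hleaf : Integrable fun t : F → ℝ => ∏ j, betaB (z j + Complex.I * t j) (y j) :=
    Integrable.fintype_prod fun j => integrable_betaB (hz j)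
  refine hleaf.mul_bdd (c := ∏ p, (Real.Gamma (x p).re * Real.Gamma ((w p).re - (x p).re) /
    ‖Complex.Gamma (w p)‖)) ?_ (Eventually.of_forall fun t => ?_)
  · refine Continuous.aestronglyMeasurable (continuous_finsetProd _ fun p _ => ?_)
    refine continuous_betaB_comp ?_ fun t => inStrip_hub hx π t p
    refine continuous_const.sub (continuous_const.mul (continuous_finsetSum _ fun j _ => ?_))
    split_ifs <;> fun_prop
  · rw [norm_prod]
    refine Finset.prod_le_prod (fun _ _ => norm_nonneg _) fun p _ => ?_
    have hre : (x p - Complex.I * ∑ j, if π j = p then (t j : ℂ) else 0).re = (x p).re := by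
      rw [← ofReal_sum_ite]
      simp
    simpa only [hre] using norm_betaB_le (inStrip_hub hx π t p)

/-- Induction on the leaves: integrating one leaf against its hub is the convolution formula, and
leaves a star with the leaf's parameters added to those of the hub. Hence the hub parameters are
generalized. -/
theorem integral_starIntegrand_fin {m : ℕ} (π : Fin m → P) {z y : Fin m → ℂ} {x w : P → ℂ}
    (hz : ∀ j, InStrip (z j) (y j)) (hx : ∀ p, InStrip (x p) (w p)) :
    ∫ t, starIntegrand π z y x w t = (2 * Real.pi) ^ m *
      ∏ p, betaB (x p + ∑ j, if π j = p then z j else 0)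
        (w p + ∑ j, if π j = p then y j else 0) := by
  induction m generalizing x w with
  | zero =>
    simp [starIntegrand, integral_unique, measureReal_def, volume_pi]
  | succ m ih =>
    have hx' : ∀ p, InStrip (x p + if π 0 = p then z 0 else 0) (w p + if π 0 = p then y 0 else 0) := by
      intro p
      split_ifs
      · exact (hx p).add (hz 0)
      · simpa using hx p
    have hinner : ∀ s : Fin m → ℝ,
        ∫ u : ℝ, starIntegrand π z y x w (Fin.cons u s : Fin (m + 1) → ℝ) =
        2 * Real.pi * starIntegrand (fun j => π j.succ) (fun j => z j.succ) (fun j => y j.succ)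
          (fun p => x p + if π 0 = p then z 0 else 0)
          (fun p => w p + if π 0 = p then y 0 else 0) s := by
      intro s
      set S : P → ℂ := fun p => ∑ j : Fin m, if π j.succ = p then (s j : ℂ) else 0 with hS
      have e : ∀ u : ℝ, starIntegrand π z y x w (Fin.cons u s : Fin (m + 1) → ℝ) =
          (∏ j : Fin m, betaB (z j.succ + Complex.I * s j) (y j.succ)) *
          (∏ p ∈ Finset.univ.erase (π 0), betaB (x p - Complex.I * S p) (w p)) *
          (betaB (z 0 + Complex.I * u) (y 0) *
            betaB (x (π 0) - Complex.I * S (π 0) - Complex.I * u) (w (π 0))) := by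
        intro u
        rw [starIntegrand, Fin.prod_univ_succ, ← Finset.mul_prod_erase Finset.univ _
          (Finset.mem_univ (π 0))]
        simp only [Fin.sum_univ_succ, Fin.cons_zero, Fin.cons_succ, if_true]
        have e1 : ∏ p ∈ Finset.univ.erase (π 0), betaB (x p - Complex.I * ((if π 0 = p then (u : ℂ)
            else 0) + ∑ j : Fin m, if π j.succ = p then (s j : ℂ) else 0)) (w p) =
            ∏ p ∈ Finset.univ.erase (π 0), betaB (x p - Complex.I * S p) (w p) := by
          refine Finset.prod_congr rfl fun p hp => ?_
          rw [if_neg (Finset.ne_of_mem_erase hp).symm, zero_add]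
        rw [e1, show x (π 0) - Complex.I * (u + ∑ j : Fin m, if π j.succ = π 0 then (s j : ℂ) else 0)
          = x (π 0) - Complex.I * S (π 0) - Complex.I * u by rw [hS]; ring]
        ring
      simp only [e]
      rw [integral_const_mul, integral_betaB_mul_betaB (hz 0)
        (inStrip_hub hx (fun j : Fin m => π j.succ) s (π 0)), starIntegrand,
        ← Finset.mul_prod_erase Finset.univ _ (Finset.mem_univ (π 0))]
      have e2 : ∏ p ∈ Finset.univ.erase (π 0), betaB (x p + (if π 0 = p then z 0 else 0) -
          Complex.I * S p) (w p + if π 0 = p then y 0 else 0) =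
          ∏ p ∈ Finset.univ.erase (π 0), betaB (x p - Complex.I * S p) (w p) := by
        refine Finset.prod_congr rfl fun p hp => ?_
        rw [if_neg (Finset.ne_of_mem_erase hp).symm, if_neg (Finset.ne_of_mem_erase hp).symm,
          add_zero, add_zero]
      simp only [if_true]
      rw [e2, show z 0 + (x (π 0) - Complex.I * S (π 0)) = x (π 0) + z 0 - Complex.I * S (π 0) by ring,
        add_comm (y 0)]
      ring
    have hmp := (volume_preserving_piFinSuccAbove (fun _ : Fin (m + 1) => ℝ) 0).symm
    have hint : Integrable fun p => starIntegrand π z y x w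
        ((MeasurableEquiv.piFinSuccAbove (fun _ : Fin (m + 1) => ℝ) 0).symm p) :=
      (hmp.integrable_comp_emb (MeasurableEquiv.measurableEmbedding _)).2
        (integrable_starIntegrand π hz hx)
    rw [← hmp.integral_comp (MeasurableEquiv.measurableEmbedding _)]
    have hcons : ∀ p : ℝ × (Fin m → ℝ),
        (MeasurableEquiv.piFinSuccAbove (fun _ : Fin (m + 1) => ℝ) 0).symm p =
          (Fin.cons p.1 p.2 : Fin (m + 1) → ℝ) := by
      intro p
      simp [MeasurableEquiv.piFinSuccAbove, Fin.insertNthEquiv]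
    rw [Measure.volume_eq_prod] at hint ⊢
    rw [integral_prod_symm _ hint]
    simp only [hcons, hinner]
    rw [integral_const_mul, ih (fun p => π p.succ) (fun j => hz j.succ) hx', pow_succ]
    simp only [Fin.sum_univ_succ, ← add_assoc]
    ring

theorem integral_starIntegrand (π : F → P) {z y : F → ℂ} {x w : P → ℂ}
    (hz : ∀ j, InStrip (z j) (y j)) (hx : ∀ p, InStrip (x p) (w p)) :
    ∫ t, starIntegrand π z y x w t = (2 * Real.pi) ^ Fintype.card F *
      ∏ p, betaB (x p + ∑ j, if π j = p then z j else 0)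
        (w p + ∑ j, if π j = p then y j else 0) := by
  have e := (Fintype.equivFin F).symm
  rw [← (volume_measurePreserving_piCongrLeft (fun _ : F => ℝ) e).integral_comp
    (MeasurableEquiv.measurableEmbedding _)]
  have h := integral_starIntegrand_fin (fun j => π (e j)) (fun j => hz (e j)) hx
  have hsum : ∀ (f : F → ℂ) (p : P), (∑ j, if π (e j) = p then f (e j) else 0) =
      ∑ j, if π j = p then f j else 0 := fun f p => e.sum_comp fun j => if π j = p then f j else 0
  simp only [hsum] at h
  rw [← h]
  refine integral_congr_ae (Eventually.of_forall fun t => ?_)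
  simp only [starIntegrand]
  have ht : ∀ j, (MeasurableEquiv.piCongrLeft (fun _ : F => ℝ) e) t (e j) = t j := fun j => by
    simp [MeasurableEquiv.coe_piCongrLeft, Equiv.piCongrLeft_apply_apply]
  rw [← e.prod_comp]
  simp only [← hsum (fun j => (((MeasurableEquiv.piCongrLeft (fun _ : F => ℝ) e) t j : ℝ) : ℂ)), ht]

end Star

/-! ### Mellin integrals over groups of variables -/

section Groups

variable {J G : Type*} {grp : G → Finset J} {piv : G → J} {γ : J → G}

theorem pivot_injective (hγ : ∀ g j, j ∈ grp g ↔ γ j = g) (hpiv : ∀ g, piv g ∈ grp g) :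
    Function.Injective piv := fun g g' h => by
  rw [← (hγ _ _).1 (hpiv g), h, (hγ _ _).1 (hpiv g')]

variable [Fintype J]

theorem shift_of_free (y : FreeVar piv → ℝ) (j : FreeVar piv) : shift grp piv y j = y j := by
  rw [shift, dif_pos j.2]

/-- The definition carries a classical `Fintype` instance on the free variables; this and the next
lemma free the later arguments from that choice. -/
theorem contourIntegrable_iff [inst : Fintype (FreeVar piv)] (f : (J → ℂ) → ℂ) (z₀ : J → ℂ) :
    ContourIntegrable grp piv f z₀ ↔
      Integrable fun y : FreeVar piv → ℝ => f (contourPoint grp piv z₀ y) := by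
  classical
  rw [ContourIntegrable]
  convert Iff.rfl

theorem contourIntegral_eq [inst : Fintype (FreeVar piv)] (f : (J → ℂ) → ℂ) (z₀ : J → ℂ) :
    contourIntegral grp piv f z₀ = (1 / (2 * Real.pi : ℂ)) ^ Fintype.card (FreeVar piv) *
      ∫ y : FreeVar piv → ℝ, f (contourPoint grp piv z₀ y) := by
  classical
  rw [contourIntegral]
  convert rfl

theorem shift_pivot [Fintype (FreeVar piv)] [DecidableEq G] (hγ : ∀ g j, j ∈ grp g ↔ γ j = g)
    (hpiv : ∀ g, piv g ∈ grp g) (y : FreeVar piv → ℝ) (g : G) :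
    shift grp piv y (piv g) = -∑ q : FreeVar piv, if γ q = g then y q else 0 := by
  rw [shift, dif_neg (fun h => h g rfl)]
  congr 1
  have h : ∀ q : FreeVar piv, (∃ g', piv g' = piv g ∧ (q : J) ∈ grp g') ↔ γ q = g := by
    refine fun q => ⟨?_, fun h => ⟨g, rfl, (hγ _ _).2 h⟩⟩
    rintro ⟨g', hg', hq⟩
    rw [pivot_injective hγ hpiv hg'] at hq
    exact (hγ _ _).1 hq
  simp only [h]
  convert rfl

/-- The variables are the free ones and the pivots. -/
noncomputable def freeSumPivot (grp : G → Finset J) (γ : J → G) (hγ : ∀ g j, j ∈ grp g ↔ γ j = g)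
    (hpiv : ∀ g, piv g ∈ grp g) : FreeVar piv ⊕ G ≃ J :=
  Equiv.ofBijective (Sum.elim Subtype.val piv) <| by
    constructor
    · refine Function.Injective.sumElim Subtype.val_injective (pivot_injective hγ hpiv) fun j g => ?_
      exact j.2 g
    · intro j
      by_cases hj : ∀ g, j ≠ piv g
      · exact ⟨Sum.inl ⟨j, hj⟩, rfl⟩
      · push Not at hj
        exact ⟨Sum.inr hj.choose, hj.choose_spec.symm⟩

variable [Fintype G] [Fintype (FreeVar piv)]

theorem sum_eq_sum_free_add_sum_pivot (hγ : ∀ g j, j ∈ grp g ↔ γ j = g)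
    (hpiv : ∀ g, piv g ∈ grp g) {R : Type*} [AddCommMonoid R] (f : J → R) :
    ∑ j, f j = ∑ j : FreeVar piv, f j + ∑ g, f (piv g) := by
  rw [← (freeSumPivot grp γ hγ hpiv).sum_comp, Fintype.sum_sum_type]
  rfl

theorem prod_eq_prod_free_mul_prod_pivot (hγ : ∀ g j, j ∈ grp g ↔ γ j = g)
    (hpiv : ∀ g, piv g ∈ grp g) {R : Type*} [CommMonoid R] (f : J → R) :
    ∏ j, f j = (∏ j : FreeVar piv, f j) * ∏ g, f (piv g) := by
  rw [← (freeSumPivot grp γ hγ hpiv).prod_comp, Fintype.prod_sum_type]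
  rfl

theorem sum_group_eq [DecidableEq G] (hγ : ∀ g j, j ∈ grp g ↔ γ j = g)
    (hpiv : ∀ g, piv g ∈ grp g) {R : Type*} [AddCommMonoid R] (f : J → R) (g : G) :
    ∑ j ∈ grp g, f j = f (piv g) + ∑ j : FreeVar piv, if γ j = g then f j else 0 := by
  have hfil : grp g = Finset.univ.filter fun j => γ j = g := by
    ext j
    simp [hγ]
  rw [hfil, Finset.sum_filter, sum_eq_sum_free_add_sum_pivot hγ hpiv, add_comm]
  congr 1
  rw [Finset.sum_eq_single g]
  · rw [if_pos ((hγ _ _).1 (hpiv g))]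
  · intro g' _ hg'
    rw [if_neg]
    rw [(hγ _ _).1 (hpiv g')]
    exact hg'
  · simp

/-- Free variables become leaves and pivots become hubs, since a pivot moves by minus the total
displacement of the free members of its group. -/
theorem prod_betaB_contourPoint [DecidableEq G] (hγ : ∀ g j, j ∈ grp g ↔ γ j = g)
    (hpiv : ∀ g, piv g ∈ grp g) (z₀ w : J → ℂ) (t : FreeVar piv → ℝ) :
    ∏ j, betaB (contourPoint grp piv z₀ t j) (w j) =
      starIntegrand (fun j : FreeVar piv => γ j) (fun j => z₀ j) (fun j => w j)
        (fun g => z₀ (piv g)) (fun g => w (piv g)) t := by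
  rw [prod_eq_prod_free_mul_prod_pivot hγ hpiv, starIntegrand]
  congr 1
  · refine Finset.prod_congr rfl fun j _ => ?_
    rw [contourPoint, shift_of_free]
  · refine Finset.prod_congr rfl fun g _ => ?_
    rw [contourPoint, shift_pivot hγ hpiv]
    rw [Complex.ofReal_neg, ofReal_sum_ite, mul_neg, sub_eq_add_neg]

omit [Fintype G] [Fintype (FreeVar piv)] in
theorem contourIntegrable_prod_betaB [Finite G] (hγ : ∀ g j, j ∈ grp g ↔ γ j = g)
    (hpiv : ∀ g, piv g ∈ grp g) {z₀ w : J → ℂ} (hz : ∀ j, InStrip (z₀ j) (w j)) :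
    ContourIntegrable grp piv (fun z => ∏ j, betaB (z j) (w j)) z₀ := by
  classical
  cases nonempty_fintype G
  rw [contourIntegrable_iff]
  simp only [prod_betaB_contourPoint hγ hpiv]
  exact integrable_starIntegrand (fun j : FreeVar piv => γ j) (fun j => hz j) (fun g => hz (piv g))

-- The source of both reduced kernels: only the group sums survive. Each free variable yields a
-- factor `2π` that its measure cancels.
omit [Fintype (FreeVar piv)] in
theorem contourIntegral_prod_betaB (hγ : ∀ g j, j ∈ grp g ↔ γ j = g)
    (hpiv : ∀ g, piv g ∈ grp g) {z₀ w : J → ℂ} (hz : ∀ j, InStrip (z₀ j) (w j)) :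
    contourIntegral grp piv (fun z => ∏ j, betaB (z j) (w j)) z₀ =
      ∏ g, betaB (∑ j ∈ grp g, z₀ j) (∑ j ∈ grp g, w j) := by
  classical
  rw [contourIntegral_eq]
  simp only [prod_betaB_contourPoint hγ hpiv]
  rw [integral_starIntegrand (fun j : FreeVar piv => γ j) (fun j => hz j) (fun g => hz (piv g)),
    ← mul_assoc, ← mul_pow]
  simp only [sum_group_eq hγ hpiv]
  have : (Real.pi : ℂ) ≠ 0 := by exact_mod_cast Real.pi_ne_zero
  rw [one_div, inv_mul_cancel₀ (by simp [this]), one_pow, one_mul]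

end Groups

/-! ### Sums over pairs of points -/

section Pairs

variable {n : ℕ} {R : Type*} [CommRing R]

/-- The sum of `τ_ij` over the pairs of points in `S`. -/
def pairsIn (τ : BPair n → R) (S : Finset (Fin n)) : R :=
  ∑ p : BPair n, if p.1.1 ∈ S ∧ p.1.2 ∈ S then τ p else 0

theorem mandelstam_eq (Δ : Fin n → ℂ) (τ : BPair n → ℂ) (S : Finset (Fin n)) :
    mandelstam Δ τ S = ∑ k ∈ S, Δ k - 2 * pairsIn τ S := rfl

theorem pairsIn_eq_zero_of_card_lt_two (τ : BPair n → R) {S : Finset (Fin n)} (hS : S.card < 2) :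
    pairsIn τ S = 0 := by
  refine Finset.sum_eq_zero fun p _ => if_neg fun h => ?_
  exact p.2.ne (Finset.card_le_one.1 (by omega) _ h.1 _ h.2)

theorem pairsIn_univ (τ : BPair n → R) : pairsIn τ Finset.univ = ∑ p, τ p := by
  simp [pairsIn]

/-- Double counting: each pair occurs once for each of its ends lying in `S`. -/
theorem sum_pairSumAt (τ : BPair n → ℂ) (S : Finset (Fin n)) :
    ∑ k ∈ S, pairSumAt τ k =
      ∑ p : BPair n, ((if p.1.1 ∈ S then τ p else 0) + if p.1.2 ∈ S then τ p else 0) := by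
  simp only [pairSumAt]
  rw [Finset.sum_comm]
  refine Finset.sum_congr rfl fun p _ => ?_
  rw [← Finset.sum_ite_eq S p.1.1 (fun _ => τ p), ← Finset.sum_ite_eq S p.1.2 (fun _ => τ p),
    ← Finset.sum_add_distrib]
  refine Finset.sum_congr rfl fun k _ => ?_
  have hp := p.2.ne
  by_cases h1 : p.1.1 = k
  · rw [if_pos (Or.inl h1), if_pos h1, if_neg (fun h2 => hp (h1.trans h2.symm)), add_zero]
  · by_cases h2 : p.1.2 = k
    · rw [if_pos (Or.inr h2), if_neg h1, if_pos h2, zero_add]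
    · rw [if_neg (by tauto), if_neg h1, if_neg h2, zero_add]

theorem sum_univ_pairSumAt (τ : BPair n → ℂ) : ∑ k, pairSumAt τ k = 2 * ∑ p, τ p := by
  rw [sum_pairSumAt]
  simp only [Finset.mem_univ, if_true, ← two_mul, Finset.mul_sum]

end Pairs

namespace OneLoopDiagram

variable {n r : ℕ} {V : Type*} [Fintype V] (D : OneLoopDiagram n r V)

/-! ### The trees attached to the loop -/

theorem mem_children {v w : V} : w ∈ D.children v ↔ D.parent w = some v := by simp [children]

theorem mem_legs {v : V} {k : Fin n} : k ∈ D.legs v ↔ D.leg k = v := by simp [legs]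

theorem mem_branchPts {v : V} {k : Fin n} : k ∈ D.branchPts v ↔ D.InBranch v (D.leg k) := by
  simp [branchPts]

theorem mem_segPts {a b : ℕ} {k : Fin n} :
    k ∈ D.segPts a b ↔ a ≤ D.pos (D.leg k) ∧ D.pos (D.leg k) ≤ b := by
  simp [segPts]

theorem segPts_of_lt {a b : ℕ} (h : b < a) : D.segPts a b = ∅ := by
  ext k
  simp only [mem_segPts, Finset.notMem_empty, iff_false]
  omega

theorem three_le_valence (v : V) :
    3 ≤ (D.children v).card + (D.legs v).card + (if D.parent v = none then 2 else 1) := by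
  simpa only [children, legs] using D.cubic v

theorem one_le_children_add_legs (v : V) : 1 ≤ (D.children v).card + (D.legs v).card := by
  have := D.three_le_valence v
  split_ifs at this <;> omega

theorem two_le_children_add_legs {v : V} (hv : ¬ D.TrivalentOnLoop v) :
    2 ≤ (D.children v).card + (D.legs v).card := by
  have := D.three_le_valence v
  have h1 := D.one_le_children_add_legs v
  rw [TrivalentOnLoop] at hv
  split_ifs at this with hp
  · have : (D.children v).card + (D.legs v).card ≠ 1 := fun h => hv ⟨hp, h⟩
    omega
  · omega

theorem not_trivalentOnLoop_of_parent {v w : V} (h : D.parent v = some w) :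
    ¬ D.TrivalentOnLoop v := fun hv => by simp [hv.1] at h

theorem not_transGen_parent (v : V) :
    ¬ Relation.TransGen (fun x y => D.parent x = some y) v v := by
  have hwf := D.wf.transGen
  intro h
  refine hwf.irrefl.irrefl v ?_
  exact (Relation.transGen_swap (r := fun x y => D.parent x = some y)).2 h

/-- The field `wf` allows induction from the loop outwards and so excludes cycles. As `V` is finite,
this also gives induction from the tips of the trees inwards. -/
theorem wf_children : WellFounded fun w v : V => D.parent w = some v := by
  let T : V → V → Prop := Relation.TransGen fun x y => D.parent x = some y
  have : IsTrans V T := ⟨fun _ _ _ => Relation.TransGen.trans⟩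
  have : Std.Irrefl T := ⟨D.not_transGen_parent⟩
  exact Subrelation.wf (r := T) (fun h => Relation.TransGen.single h)
    (Finite.wellFounded_of_trans_of_irrefl T)

theorem pos_mem_Icc (v : V) : 1 ≤ D.pos v ∧ D.pos v ≤ r := by
  induction v using D.wf.induction with
  | h v ih =>
    cases hv : D.parent v with
    | none => exact D.pos_bijOn.mapsTo hv
    | some w =>
      rw [D.pos_parent v w hv]
      exact ih w hv

variable {D}

theorem InBranch.pos_eq {v w : V} (h : D.InBranch v w) : D.pos w = D.pos v := by
  induction h with
  | refl => rfl
  | tail _ h ih => rw [ih, D.pos_parent _ _ h]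

theorem inBranch_iff {v w : V} :
    D.InBranch v w ↔ w = v ∨ ∃ c, D.parent c = some v ∧ D.InBranch c w := by
  constructor
  · intro h
    rcases Relation.ReflTransGen.cases_tail h with h | ⟨c, hc, hv⟩
    · exact Or.inl h.symm
    · exact Or.inr ⟨c, hv, hc⟩
  · rintro (rfl | ⟨c, hv, hc⟩)
    · exact Relation.ReflTransGen.refl
    · exact Relation.ReflTransGen.tail hc hv

theorem InBranch.total {v v' w : V} (h : D.InBranch v w) (h' : D.InBranch v' w) :
    D.InBranch v' v ∨ D.InBranch v v' := by
  refine Relation.ReflTransGen.total_of_right_unique (fun a b c hb hc => ?_) h h'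
  exact Option.some_injective _ (hb.symm.trans hc)

theorem not_inBranch_child {v c : V} (hc : D.parent c = some v) : ¬ D.InBranch c v := fun h =>
  D.not_transGen_parent c (Relation.TransGen.head' hc h)

/-- Since `parent` is a function, the ancestors of `w` form a chain, so `c` and `c'` are comparable.
If they differed, one would lie in the branch of the other, and `v` would be its own ancestor. -/
theorem child_unique {v c c' w : V} (hc : D.parent c = some v) (hc' : D.parent c' = some v)
    (h : D.InBranch c w) (h' : D.InBranch c' w) : c = c' := by
  have key : ∀ {a b : V}, D.parent a = some v → D.parent b = some v → D.InBranch a b → a = b := by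
    intro a b ha hb hab
    rcases Relation.ReflTransGen.cases_head hab with h | ⟨x, hx, hxa⟩
    · exact h.symm
    · rw [hb] at hx
      obtain rfl := Option.some_injective _ hx
      exact absurd hxa (not_inBranch_child ha)
  rcases h.total h' with h | h
  · exact (key hc' hc h).symm
  · exact key hc hc' h

variable (D)

theorem exists_root (w : V) : ∃ v, D.parent v = none ∧ D.InBranch v w := by
  induction w using D.wf.induction with
  | h w ih =>
    cases hw : D.parent w with
    | none => exact ⟨w, hw, Relation.ReflTransGen.refl⟩
    | some x =>
      obtain ⟨v, hv, hvx⟩ := ih x hw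
      exact ⟨v, hv, Relation.ReflTransGen.head hw hvx⟩

/-- `pos` is constant along each tree and injective on the loop, so it identifies the tree. -/
theorem inBranch_root_iff {v w : V} (hv : D.parent v = none) :
    D.InBranch v w ↔ D.pos w = D.pos v := by
  refine ⟨InBranch.pos_eq, fun h => ?_⟩
  obtain ⟨v', hv', hw⟩ := D.exists_root w
  have : v' = v := D.pos_bijOn.injOn hv' hv (hw.pos_eq.symm.trans h)
  rwa [← this]

theorem exists_root_pos {a : ℕ} (h1 : 1 ≤ a) (h2 : a ≤ r) :
    ∃ v, D.parent v = none ∧ D.pos v = a :=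
  D.pos_bijOn.surjOn ⟨h1, h2⟩

theorem branchPts_root {v : V} (hv : D.parent v = none) :
    D.branchPts v = D.segPts (D.pos v) (D.pos v) := by
  ext k
  rw [mem_branchPts, mem_segPts, D.inBranch_root_iff hv]
  omega

theorem segPts_one_r : D.segPts 1 r = Finset.univ := by
  ext k
  simpa [mem_segPts] using D.pos_mem_Icc (D.leg k)

theorem mem_branchPts_iff {v : V} {k : Fin n} :
    k ∈ D.branchPts v ↔ k ∈ D.legs v ∨ ∃ c ∈ D.children v, k ∈ D.branchPts c := by
  simp only [mem_branchPts, mem_legs, mem_children]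
  exact inBranch_iff

theorem branchPts_child_subset {v c : V} (hc : c ∈ D.children v) :
    D.branchPts c ⊆ D.branchPts v := fun _ hk => D.mem_branchPts_iff.2 (Or.inr ⟨c, hc, hk⟩)

theorem legs_subset_branchPts (v : V) : D.legs v ⊆ D.branchPts v := fun _ hk =>
  D.mem_branchPts_iff.2 (Or.inl hk)

theorem notMem_legs_of_mem_child {v c : V} (hc : c ∈ D.children v) {k : Fin n}
    (hk : k ∈ D.branchPts c) : k ∉ D.legs v := by
  rw [mem_legs]
  rintro rfl
  exact not_inBranch_child (D.mem_children.1 hc) (D.mem_branchPts.1 hk)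

theorem eq_of_mem_children {v c c' : V} (hc : c ∈ D.children v) (hc' : c' ∈ D.children v)
    {k : Fin n} (hk : k ∈ D.branchPts c) (hk' : k ∈ D.branchPts c') : c = c' :=
  child_unique (D.mem_children.1 hc) (D.mem_children.1 hc') (D.mem_branchPts.1 hk)
    (D.mem_branchPts.1 hk')

theorem branchPts_nonempty (v : V) : (D.branchPts v).Nonempty := by
  induction v using D.wf_children.induction with
  | h v ih =>
    have h1 := D.one_le_children_add_legs v
    rcases Finset.eq_empty_or_nonempty (D.legs v) with h | ⟨k, hk⟩
    · rw [h, Finset.card_empty, add_zero] at h1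
      obtain ⟨c, hc⟩ := Finset.card_pos.1 h1
      exact (ih c (D.mem_children.1 hc)).mono (D.branchPts_child_subset hc)
    · exact ⟨k, D.legs_subset_branchPts v hk⟩

theorem segPts_self_nonempty {a : ℕ} (h1 : 1 ≤ a) (h2 : a ≤ r) : (D.segPts a a).Nonempty := by
  obtain ⟨v, hv, rfl⟩ := D.exists_root_pos h1 h2
  exact D.branchPts_root hv ▸ D.branchPts_nonempty v

/-- A vertex with at least two legs or children separates two of the points of its branch. -/
theorem exists_separated_pair {v : V} (hv : ¬ D.TrivalentOnLoop v) :
    ∃ i ∈ D.branchPts v, ∃ j ∈ D.branchPts v, i ≠ j ∧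
      ∀ c ∈ D.children v, ¬ (i ∈ D.branchPts c ∧ j ∈ D.branchPts c) := by
  have h2 := D.two_le_children_add_legs hv
  by_cases hl : 1 < (D.legs v).card
  · obtain ⟨i, hi, j, hj, hij⟩ := Finset.one_lt_card.1 hl
    exact ⟨i, D.legs_subset_branchPts v hi, j, D.legs_subset_branchPts v hj, hij,
      fun c hc h => D.notMem_legs_of_mem_child hc h.1 hi⟩
  by_cases hl' : (D.legs v).card = 1
  · obtain ⟨i, hi⟩ := Finset.card_pos.1 (by omega : 0 < (D.legs v).card)
    obtain ⟨c, hc⟩ := Finset.card_pos.1 (by omega : 0 < (D.children v).card)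
    obtain ⟨j, hj⟩ := D.branchPts_nonempty c
    refine ⟨i, D.legs_subset_branchPts v hi, j, D.branchPts_child_subset hc hj, ?_,
      fun c hc h => D.notMem_legs_of_mem_child hc h.1 hi⟩
    rintro rfl
    exact D.notMem_legs_of_mem_child hc hj hi
  · obtain ⟨c, hc, c', hc', hcc⟩ := Finset.one_lt_card.1 (by omega : 1 < (D.children v).card)
    obtain ⟨i, hi⟩ := D.branchPts_nonempty c
    obtain ⟨j, hj⟩ := D.branchPts_nonempty c'
    refine ⟨i, D.branchPts_child_subset hc hi, j, D.branchPts_child_subset hc' hj, ?_, ?_⟩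
    · rintro rfl
      exact hcc (D.eq_of_mem_children hc hc' hi hj)
    · rintro x hx ⟨h1, h2⟩
      exact hcc ((D.eq_of_mem_children hc hx hi h1).trans (D.eq_of_mem_children hc' hx hj h2).symm)

theorem two_le_card_branchPts {v : V} (hv : ¬ D.TrivalentOnLoop v) :
    2 ≤ (D.branchPts v).card := by
  obtain ⟨i, hi, j, hj, hij, -⟩ := D.exists_separated_pair hv
  exact Finset.one_lt_card.2 ⟨i, hi, j, hj, hij⟩

/-- The third propagator of a trivalent vertex of the loop leads to a tree or to a point. -/
theorem TrivalentOnLoop.cases {v : V} (hv : D.TrivalentOnLoop v) :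
    (∃ c, D.children v = {c} ∧ D.branchPts v = D.branchPts c) ∨ (D.branchPts v).card = 1 := by
  have h := hv.2
  rcases Nat.eq_zero_or_pos (D.legs v).card with hl | hl
  · rw [hl, add_zero] at h
    obtain ⟨c, hc⟩ := Finset.card_eq_one.1 h
    refine Or.inl ⟨c, hc, ?_⟩
    ext k
    rw [mem_branchPts_iff, hc, Finset.card_eq_zero.1 hl]
    simp
  · have hc : D.children v = ∅ := Finset.card_eq_zero.1 (by omega)
    have : D.branchPts v = D.legs v := by
      ext k
      rw [mem_branchPts_iff, hc]
      simp
    exact Or.inr (by rw [this]; omega)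

/-! ### The groups of Mellin variables -/

noncomputable instance : Fintype {a : ℕ // 1 ≤ a ∧ a ≤ r} :=
  Fintype.subtype (Finset.Icc 1 r) fun a => by simp

noncomputable instance : Fintype {x : ℕ × ℕ // 1 ≤ x.1 ∧ x.1 < x.2 ∧ x.2 ≤ r} :=
  Fintype.subtype ((Finset.Icc 1 r ×ˢ Finset.Icc 1 r).filter fun x => x.1 < x.2) fun x => by
    simp only [Finset.mem_filter, Finset.mem_product, Finset.mem_Icc]
    omega

open Classical in
noncomputable instance : Fintype {v : V // ¬ D.TrivalentOnLoop v} := inferInstance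

theorem mem_pairGroup_inl {x : {x : ℕ × ℕ // 1 ≤ x.1 ∧ x.1 < x.2 ∧ x.2 ≤ r}} {p : BPair n} :
    p ∈ D.pairGroup (Sum.inl x) ↔
      (D.pos (D.leg p.1.1) = x.1.1 ∧ D.pos (D.leg p.1.2) = x.1.2) ∨
        (D.pos (D.leg p.1.1) = x.1.2 ∧ D.pos (D.leg p.1.2) = x.1.1) := by
  simp [pairGroup]

theorem mem_pairGroup_inr {v : {v : V // ¬ D.TrivalentOnLoop v}} {p : BPair n} :
    p ∈ D.pairGroup (Sum.inr v) ↔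
      (p.1.1 ∈ D.branchPts v ∧ p.1.2 ∈ D.branchPts v) ∧
        ∀ c ∈ D.children v, ¬ (p.1.1 ∈ D.branchPts c ∧ p.1.2 ∈ D.branchPts c) := by
  simp [pairGroup]

theorem exists_lowest_branch {i j : Fin n} (v : V) (hi : i ∈ D.branchPts v)
    (hj : j ∈ D.branchPts v) : ∃ w, (i ∈ D.branchPts w ∧ j ∈ D.branchPts w) ∧
      ∀ c ∈ D.children w, ¬ (i ∈ D.branchPts c ∧ j ∈ D.branchPts c) := by
  induction v using D.wf_children.induction with
  | h v ih =>
    by_cases h : ∃ c ∈ D.children v, i ∈ D.branchPts c ∧ j ∈ D.branchPts c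
    · obtain ⟨c, hc, hci, hcj⟩ := h
      exact ih c (D.mem_children.1 hc) hci hcj
    · push Not at h
      exact ⟨v, ⟨hi, hj⟩, fun c hc hh => h c hc hh.1 hh.2⟩

theorem lowest_branch_unique {i j : Fin n} {v w : V}
    (hv : i ∈ D.branchPts v ∧ j ∈ D.branchPts v)
    (hv' : ∀ c ∈ D.children v, ¬ (i ∈ D.branchPts c ∧ j ∈ D.branchPts c))
    (hw : i ∈ D.branchPts w ∧ j ∈ D.branchPts w)
    (hw' : ∀ c ∈ D.children w, ¬ (i ∈ D.branchPts c ∧ j ∈ D.branchPts c)) : v = w := by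
  have key : ∀ {a b : V}, (∀ c ∈ D.children a, ¬ (i ∈ D.branchPts c ∧ j ∈ D.branchPts c)) →
      (i ∈ D.branchPts b ∧ j ∈ D.branchPts b) → D.InBranch a b → a = b := by
    intro a b ha hb hab
    rcases inBranch_iff.1 hab with h | ⟨c, hc, hcb⟩
    · exact h.symm
    · refine absurd ⟨?_, ?_⟩ (ha c (D.mem_children.2 hc))
      · exact D.mem_branchPts.2 (Relation.ReflTransGen.trans (D.mem_branchPts.1 hb.1) hcb)
      · exact D.mem_branchPts.2 (Relation.ReflTransGen.trans (D.mem_branchPts.1 hb.2) hcb)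
  rcases (D.mem_branchPts.1 hv.1).total (D.mem_branchPts.1 hw.1) with h | h
  · exact (key hw' hv h).symm
  · exact key hv' hw h

/-- Pairs at distinct places belong to a cross group. At equal places the label is the lowest vertex
whose branch holds both points, which is unique because common ancestors form a chain. -/
theorem existsUnique_mem_pairGroup (p : BPair n) : ∃! g, p ∈ D.pairGroup g := by
  by_cases hpos : D.pos (D.leg p.1.1) = D.pos (D.leg p.1.2)
  · obtain ⟨v, hv, hvi⟩ := D.exists_root (D.leg p.1.1)
    obtain ⟨w, hw, hw'⟩ := D.exists_lowest_branch v (D.mem_branchPts.2 hvi)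
      (D.mem_branchPts.2 ((D.inBranch_root_iff hv).2 (hpos.symm.trans hvi.pos_eq)))
    -- A trivalent loop vertex is never lowest: either its only child carries all of its points, or
    -- it has just one point.
    have hwt : ¬ D.TrivalentOnLoop w := by
      intro ht
      rcases ht.cases with ⟨c, hc, hcb⟩ | h1
      · exact hw' c (by simp [hc]) (hcb ▸ hw)
      · exact p.2.ne (Finset.card_le_one.1 h1.le _ hw.1 _ hw.2)
    refine ⟨Sum.inr ⟨w, hwt⟩, D.mem_pairGroup_inr.2 ⟨hw, hw'⟩, ?_⟩
    rintro (x | x) hx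
    · rw [mem_pairGroup_inl] at hx
      have := x.2
      omega
    · rw [mem_pairGroup_inr] at hx
      exact congrArg Sum.inr (Subtype.ext (D.lowest_branch_unique hx.1 hx.2 hw hw'))
  · have h1 := D.pos_mem_Icc (D.leg p.1.1)
    have h2 := D.pos_mem_Icc (D.leg p.1.2)
    refine ⟨Sum.inl ⟨(min (D.pos (D.leg p.1.1)) (D.pos (D.leg p.1.2)),
      max (D.pos (D.leg p.1.1)) (D.pos (D.leg p.1.2))), by simp only; omega⟩, ?_, ?_⟩
    · simp only [mem_pairGroup_inl]
      omega
    · rintro (x | x) hx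
      · rw [mem_pairGroup_inl] at hx
        refine congrArg Sum.inl (Subtype.ext (Prod.ext ?_ ?_)) <;>
        · have := x.2
          simp only
          omega
      · rw [mem_pairGroup_inr, mem_branchPts, mem_branchPts] at hx
        exact absurd (hx.1.1.pos_eq.trans hx.1.2.pos_eq.symm) hpos

/-- The label of the group to which a pair of points belongs. -/
noncomputable def pairLabel (p : BPair n) : D.PairGroup := (D.existsUnique_mem_pairGroup p).choose

theorem mem_pairGroup_iff (g : D.PairGroup) (p : BPair n) :
    p ∈ D.pairGroup g ↔ D.pairLabel p = g := by
  have h := (D.existsUnique_mem_pairGroup p).choose_spec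
  refine ⟨fun hg => (h.2 g hg).symm, ?_⟩
  rintro rfl
  exact h.1

theorem exists_bpair {n : ℕ} {i j : Fin n} (hij : i ≠ j) : ∃ p : BPair n,
    (p.1.1 = i ∧ p.1.2 = j) ∨ (p.1.1 = j ∧ p.1.2 = i) := by
  rcases lt_or_gt_of_ne hij with h | h
  · exact ⟨⟨(i, j), h⟩, Or.inl ⟨rfl, rfl⟩⟩
  · exact ⟨⟨(j, i), h⟩, Or.inr ⟨rfl, rfl⟩⟩

/-- Ensures that pivots exist. It rests on the valence condition: every branch contains a point, and
every vertex labelling a group separates two points. -/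
theorem pairGroup_nonempty (g : D.PairGroup) : (D.pairGroup g).Nonempty := by
  rcases g with ⟨⟨a, b⟩, ha, hab, hb⟩ | ⟨v, hv⟩
  · obtain ⟨i, hi⟩ := D.segPts_self_nonempty ha (hab.le.trans hb)
    obtain ⟨j, hj⟩ := D.segPts_self_nonempty (ha.trans hab.le) hb
    simp only [mem_segPts] at hi hj hab
    have hij : i ≠ j := by rintro rfl; omega
    obtain ⟨p, hp⟩ := exists_bpair hij
    refine ⟨p, D.mem_pairGroup_inl.2 ?_⟩
    rcases hp with ⟨h1, h2⟩ | ⟨h1, h2⟩ <;> rw [h1, h2] <;> simp only <;> omega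
  · obtain ⟨i, hi, j, hj, hij, hc⟩ := D.exists_separated_pair hv
    obtain ⟨p, hp⟩ := exists_bpair hij
    refine ⟨p, D.mem_pairGroup_inr.2 ?_⟩
    rcases hp with ⟨h1, h2⟩ | ⟨h1, h2⟩ <;> rw [h1, h2]
    · exact ⟨⟨hi, hj⟩, hc⟩
    · exact ⟨⟨hj, hi⟩, fun c hcc h => hc c hcc h.symm⟩

/-- The label of the group to which `τ_{k,n+1}` belongs. -/
def lastLabel (k : Fin n) : {a : ℕ // 1 ≤ a ∧ a ≤ r} := ⟨D.pos (D.leg k), D.pos_mem_Icc _⟩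

theorem mem_lastGroup_iff (a : {a : ℕ // 1 ≤ a ∧ a ≤ r}) (k : Fin n) :
    k ∈ D.lastGroup a ↔ D.lastLabel k = a := by
  rw [lastGroup, mem_segPts, lastLabel, Subtype.ext_iff]
  simp only
  omega

/-! ### Sums over the groups -/

section Sums

variable {R : Type*} [CommRing R]

/-- Inclusion-exclusion: a pair inside the segment survives exactly when removing either end of the
segment loses one of its points, so the points sit at the two ends. -/
theorem sum_pairGroup_inl (τ : BPair n → R) (x : {x : ℕ × ℕ // 1 ≤ x.1 ∧ x.1 < x.2 ∧ x.2 ≤ r}) :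
    ∑ p ∈ D.pairGroup (Sum.inl x), τ p =
      pairsIn τ (D.segPts x.1.1 x.1.2) - pairsIn τ (D.segPts x.1.1 (x.1.2 - 1)) -
        pairsIn τ (D.segPts (x.1.1 + 1) x.1.2) + pairsIn τ (D.segPts (x.1.1 + 1) (x.1.2 - 1)) := by
  classical
  obtain ⟨⟨a, b⟩, ha, hab, hb⟩ := x
  simp only at ha hab hb
  have hfil : D.pairGroup (Sum.inl ⟨(a, b), ha, hab, hb⟩) = Finset.univ.filter fun p : BPair n =>
      (D.pos (D.leg p.1.1) = a ∧ D.pos (D.leg p.1.2) = b) ∨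
        (D.pos (D.leg p.1.1) = b ∧ D.pos (D.leg p.1.2) = a) := by
    ext p
    simp [mem_pairGroup_inl]
  rw [hfil, Finset.sum_filter]
  simp only [pairsIn, ← Finset.sum_sub_distrib, ← Finset.sum_add_distrib, mem_segPts]
  refine Finset.sum_congr rfl fun p _ => ?_
  generalize D.pos (D.leg p.1.1) = i
  generalize D.pos (D.leg p.1.2) = j
  split_ifs <;> first | (exfalso; omega) | simp

/-- The branches of distinct children are disjoint, so a pair of points is subtracted at most once.
-/
theorem sum_pairGroup_inr (τ : BPair n → R) (v : {v : V // ¬ D.TrivalentOnLoop v}) :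
    ∑ p ∈ D.pairGroup (Sum.inr v), τ p =
      pairsIn τ (D.branchPts v) - ∑ c ∈ D.children v, pairsIn τ (D.branchPts c) := by
  classical
  have hfil : D.pairGroup (Sum.inr v) = Finset.univ.filter fun p : BPair n =>
      (p.1.1 ∈ D.branchPts v ∧ p.1.2 ∈ D.branchPts v) ∧
        ∀ c ∈ D.children v, ¬ (p.1.1 ∈ D.branchPts c ∧ p.1.2 ∈ D.branchPts c) := by
    ext p
    simp [mem_pairGroup_inr]
  rw [hfil, Finset.sum_filter]
  simp only [pairsIn]
  rw [Finset.sum_comm, ← Finset.sum_sub_distrib]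
  refine Finset.sum_congr rfl fun p _ => ?_
  by_cases hc : ∃ c ∈ D.children v, p.1.1 ∈ D.branchPts c ∧ p.1.2 ∈ D.branchPts c
  · obtain ⟨c, hc, hp⟩ := hc
    rw [if_neg (fun h => h.2 c hc hp), Finset.sum_eq_single c, if_pos hp, if_pos, sub_self]
    · exact ⟨D.branchPts_child_subset hc hp.1, D.branchPts_child_subset hc hp.2⟩
    · intro c' hc' hne
      exact if_neg fun h => hne (D.eq_of_mem_children hc' hc h.1 hp.1)
    · exact fun h => absurd hc h
  · push Not at hc
    rw [Finset.sum_eq_zero fun c hcc => if_neg fun h => hc c hcc h.1 h.2, sub_zero]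
    refine if_congr ⟨fun h => h.1, fun h => ⟨h, fun c hcc hh => hc c hcc hh.1 hh.2⟩⟩ rfl rfl

theorem sum_segPts_self (f : Fin n → R) {a : ℕ} (ha : a ≤ r) :
    ∑ k ∈ D.segPts a a, f k = ∑ k ∈ D.segPts a r, f k - ∑ k ∈ D.segPts (a + 1) r, f k := by
  simp only [segPts, Finset.sum_filter, ← Finset.sum_sub_distrib]
  refine Finset.sum_congr rfl fun k _ => ?_
  split_ifs <;> first | (exfalso; omega) | simp

theorem sum_segPts_self' (f : Fin n → R) {a : ℕ} (ha : 1 ≤ a) :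
    ∑ k ∈ D.segPts a a, f k = ∑ k ∈ D.segPts 1 a, f k - ∑ k ∈ D.segPts 1 (a - 1), f k := by
  simp only [segPts, Finset.sum_filter, ← Finset.sum_sub_distrib]
  refine Finset.sum_congr rfl fun k _ => ?_
  split_ifs <;> first | (exfalso; omega) | simp

theorem sum_branchPts (f : Fin n → R) (v : V) :
    ∑ k ∈ D.branchPts v, f k =
      ∑ k ∈ D.legs v, f k + ∑ c ∈ D.children v, ∑ k ∈ D.branchPts c, f k := by
  classical
  have hU : D.branchPts v = D.legs v ∪ (D.children v).biUnion D.branchPts := by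
    ext k
    rw [mem_branchPts_iff]
    simp
  have hd : Disjoint (D.legs v) ((D.children v).biUnion D.branchPts) := by
    rw [Finset.disjoint_biUnion_right]
    exact fun c hc => Finset.disjoint_right.2 fun k hk => D.notMem_legs_of_mem_child hc hk
  rw [hU, Finset.sum_union hd, Finset.sum_biUnion]
  intro c hc c' hc' hne
  exact Finset.disjoint_left.2 fun k hk hk' => hne (D.eq_of_mem_children hc hc' hk hk')

end Sums

/-- The first difference collects the pairs that meet place `a` and have no point before it, the
second those that have no point after it. Pairs inside place `a` occur in both, matching their two
ends. -/
theorem sum_segPts_pairSumAt (τ : BPair n → ℂ) {a : ℕ} (h1 : 1 ≤ a) (h2 : a ≤ r) :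
    ∑ k ∈ D.segPts a a, pairSumAt τ k =
      pairsIn τ (D.segPts a r) - pairsIn τ (D.segPts (a + 1) r) +
        (pairsIn τ (D.segPts 1 a) - pairsIn τ (D.segPts 1 (a - 1))) := by
  rw [sum_pairSumAt]
  simp only [pairsIn, ← Finset.sum_sub_distrib, ← Finset.sum_add_distrib, mem_segPts]
  refine Finset.sum_congr rfl fun p _ => ?_
  have hi := D.pos_mem_Icc (D.leg p.1.1)
  have hj := D.pos_mem_Icc (D.leg p.1.2)
  generalize D.pos (D.leg p.1.1) = i at *
  generalize D.pos (D.leg p.1.2) = j at *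
  rcases lt_trichotomy i a with h | h | h <;> rcases lt_trichotomy j a with h' | h' | h' <;>
    simp only [show (a ≤ i ∧ i ≤ a) = (i = a) from propext (by omega),
      show (a ≤ j ∧ j ≤ a) = (j = a) from propext (by omega),
      show (a ≤ i ∧ i ≤ r) = (a ≤ i) from propext (by omega),
      show (a ≤ j ∧ j ≤ r) = (a ≤ j) from propext (by omega)] <;>
    split_ifs <;> first | (exfalso; omega) | simp

/-! ### The two parts of the reduced kernel -/

theorem crossArg_loopMand (Δ : Fin n → ℂ) (τ : BPair n → ℂ)
    (x : {x : ℕ × ℕ // 1 ≤ x.1 ∧ x.1 < x.2 ∧ x.2 ≤ r}) :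
    crossArg (D.loopMand Δ τ) x.1.1 x.1.2 = ∑ p ∈ D.pairGroup (Sum.inl x), τ p := by
  have hΔ : ∑ k ∈ D.segPts x.1.1 x.1.2, Δ k - ∑ k ∈ D.segPts x.1.1 (x.1.2 - 1), Δ k -
      ∑ k ∈ D.segPts (x.1.1 + 1) x.1.2, Δ k + ∑ k ∈ D.segPts (x.1.1 + 1) (x.1.2 - 1), Δ k = 0 := by
    obtain ⟨⟨a, b⟩, ha, hab, hb⟩ := x
    simp only at ha hab hb
    simp only [segPts, Finset.sum_filter, ← Finset.sum_sub_distrib, ← Finset.sum_add_distrib]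
    refine Finset.sum_eq_zero fun k _ => ?_
    split_ifs <;> first | (exfalso; omega) | simp
  rw [sum_pairGroup_inl]
  simp only [crossArg, loopMand, mandelstam_eq]
  linear_combination -(1 / 2 : ℂ) * hΔ

theorem vertexArg_branchMand (Δ : Fin n → ℂ) (τ : BPair n → ℂ)
    (v : {v : V // ¬ D.TrivalentOnLoop v}) :
    D.vertexArg Δ (D.branchMand Δ τ) v = ∑ p ∈ D.pairGroup (Sum.inr v), τ p := by
  rw [sum_pairGroup_inr]
  simp only [vertexArg, branchMand, mandelstam_eq, Finset.sum_sub_distrib, ← Finset.mul_sum]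
  rw [sum_branchPts]
  ring

theorem chainMand_succ (Δ : Fin n → ℂ) (h : ℝ) (c : ℂ) (τ : BPair n → ℂ) (u : Fin n → ℂ) {a : ℕ}
    (ha : a ≤ r) :
    ((D.loopMand Δ τ a r - D.loopMand Δ τ (a + 1) r) -
      (D.chainMand Δ h c τ u a - D.chainMand Δ h c τ u (a + 1))) / 2 =
      ∑ k ∈ D.segPts a a, u k := by
  rw [D.sum_segPts_self u ha, chainMand, chainMand, loopMand, loopMand]
  ring

/-- Identifies the denominator argument of `K₂red` with the group sum of `τ_{0k} + τ_{k,n+1}`. -/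
theorem loopMand_sub_loopMand (Δ : Fin n → ℂ) (τ : BPair n → ℂ) {a : ℕ} (h1 : 1 ≤ a) (ha : a ≤ r) :
    ((D.loopMand Δ τ a r - D.loopMand Δ τ (a + 1) r) -
      (D.loopMand Δ τ 1 (a - 1) - D.loopMand Δ τ 1 a)) / 2 =
      ∑ k ∈ D.segPts a a, (Δ k - pairSumAt τ k) := by
  rw [Finset.sum_sub_distrib, D.sum_segPts_pairSumAt τ h1 ha]
  simp only [loopMand, mandelstam_eq]
  linear_combination -(1 / 2 : ℂ) * D.sum_segPts_self Δ ha -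
    (1 / 2 : ℂ) * D.sum_segPts_self' Δ h1

/-- The second beta argument is written without `u`, hence stays fixed while the `τ_{k,n+1}` are
integrated. -/
theorem K₂pre_eq (Δ : Fin n → ℂ) (τ : BPair n → ℂ) (u : Fin n → ℂ) :
    K₂pre Δ τ u = ∏ k, betaB (u k) (Δ k - pairSumAt τ k) := by
  refine Finset.prod_congr rfl fun k _ => ?_
  rw [betaB, tauZero]
  ring_nf

theorem K₁pre_eq (δ τ : BPair n → ℂ) : K₁pre δ τ = ∏ p, betaB (τ p) (δ p) := rfl

variable {Δ : Fin n → ℂ} {δ τ : BPair n → ℂ} {u : Fin n → ℂ}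

theorem _root_.WittenMellin.Separating.inStrip_last (hsep : Separating Δ δ τ u) (k : Fin n) :
    InStrip (u k) (Δ k - pairSumAt τ k) := by
  refine ⟨hsep.last_pos k, ?_⟩
  have := hsep.zero_pos k
  rw [tauZero] at this
  simp only [Complex.sub_re] at this ⊢
  linarith

theorem _root_.WittenMellin.Separating.inStrip_pair (hsep : Separating Δ δ τ u) (p : BPair n) :
    InStrip (τ p) (δ p) :=
  ⟨hsep.pair_pos p, hsep.pair_lt p⟩

theorem K₂red_eq (h : ℝ) (c : ℂ) :
    K₂red (r := r) (D.chainMand Δ h c τ u) (D.loopMand Δ τ) =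
      ∏ a, betaB (∑ k ∈ D.lastGroup a, u k) (∑ k ∈ D.lastGroup a, (Δ k - pairSumAt τ k)) := by
  rw [K₂red, Finset.prod_subtype (p := fun a => 1 ≤ a ∧ a ≤ r) _ (by simp)]
  refine Finset.prod_congr rfl fun a _ => ?_
  rw [D.loopMand_sub_loopMand Δ τ a.2.1 a.2.2, D.chainMand_succ Δ h c τ u a.2.2, betaB, lastGroup]
  congr 1
  -- Back in Mandelstam form, the difference of the two beta arguments is visibly the middle Gamma
  -- argument.
  rw [← D.loopMand_sub_loopMand Δ τ a.2.1 a.2.2, ← D.chainMand_succ Δ h c τ u a.2.2]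
  congr 2
  ring

theorem contourIntegral_K₂pre (hsep : Separating Δ δ τ u) (h : ℝ) (c : ℂ)
    {κ : {a : ℕ // 1 ≤ a ∧ a ≤ r} → Fin n} (hκ : ∀ a, κ a ∈ D.lastGroup a) :
    ContourIntegrable D.lastGroup κ (K₂pre Δ τ) u ∧
      contourIntegral D.lastGroup κ (K₂pre Δ τ) u =
        K₂red (r := r) (D.chainMand Δ h c τ u) (D.loopMand Δ τ) := by
  have hf : K₂pre Δ τ = fun u => ∏ k, betaB (u k) (Δ k - pairSumAt τ k) :=
    funext fun u => K₂pre_eq Δ τ u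
  rw [hf, K₂red_eq]
  exact ⟨contourIntegrable_prod_betaB D.mem_lastGroup_iff hκ hsep.inStrip_last,
    contourIntegral_prod_betaB D.mem_lastGroup_iff hκ hsep.inStrip_last⟩

theorem K₁red_eq :
    D.K₁red Δ (D.loopMand Δ τ) (D.branchMand Δ τ) (D.loopMand Δ δ) (D.branchMand Δ δ) =
      ∏ g, betaB (∑ p ∈ D.pairGroup g, τ p) (∑ p ∈ D.pairGroup g, δ p) := by
  classical
  rw [Fintype.prod_sum_type, K₁red]
  congr 1
  · have h : ∀ F : ℕ → ℕ → ℂ, ∏ a ∈ Finset.Icc 1 r, ∏ b ∈ Finset.Icc (a + 1) r, F a b =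
        ∏ x : {x : ℕ × ℕ // 1 ≤ x.1 ∧ x.1 < x.2 ∧ x.2 ≤ r}, F x.1.1 x.1.2 := by
      intro F
      rw [← Finset.prod_subtype ((Finset.Icc 1 r ×ˢ Finset.Icc 1 r).filter fun x => x.1 < x.2)
        (p := fun x : ℕ × ℕ => 1 ≤ x.1 ∧ x.1 < x.2 ∧ x.2 ≤ r) (fun x => by
          simp only [Finset.mem_filter, Finset.mem_product, Finset.mem_Icc]; omega)
        (fun x => F x.1 x.2), Finset.prod_filter, Finset.prod_product]
      refine Finset.prod_congr rfl fun a ha => ?_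
      rw [← Finset.prod_filter]
      refine Finset.prod_congr ?_ fun _ _ => rfl
      ext b
      simp only [Finset.mem_filter, Finset.mem_Icc] at ha ⊢
      omega
    rw [h]
    refine Finset.prod_congr rfl fun x _ => ?_
    rw [crossArg_loopMand, crossArg_loopMand]
  · have h : ∀ F : V → ℂ, ∏ p ∈ Finset.Icc 1 r,
        ∏ v ∈ Finset.univ.filter (fun v => D.pos v = p ∧ ¬ D.TrivalentOnLoop v), F v =
        ∏ v : {v : V // ¬ D.TrivalentOnLoop v}, F v := by
      intro F
      rw [← Finset.prod_subtype (Finset.univ.filter fun v => ¬ D.TrivalentOnLoop v)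
        (p := fun v => ¬ D.TrivalentOnLoop v) (fun v => by simp) F,
        ← Finset.prod_fiberwise_of_maps_to (g := D.pos) (t := Finset.Icc 1 r)
          (fun v _ => Finset.mem_Icc.2 (D.pos_mem_Icc v))]
      refine Finset.prod_congr rfl fun p _ => Finset.prod_congr ?_ fun _ _ => rfl
      ext v
      simp [and_comm]
    rw [h fun v => betaB (D.vertexArg Δ (D.branchMand Δ τ) v) (D.vertexArg Δ (D.branchMand Δ δ) v)]
    refine Finset.prod_congr rfl fun v _ => ?_
    rw [vertexArg_branchMand, vertexArg_branchMand]

theorem contourIntegral_K₁pre (hsep : Separating Δ δ τ u)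
    {ρ : D.PairGroup → BPair n} (hρ : ∀ g, ρ g ∈ D.pairGroup g) :
    ContourIntegrable D.pairGroup ρ (K₁pre δ) τ ∧
      contourIntegral D.pairGroup ρ (K₁pre δ) τ =
        D.K₁red Δ (D.loopMand Δ τ) (D.branchMand Δ τ) (D.loopMand Δ δ) (D.branchMand Δ δ) := by
  have hf : K₁pre δ = fun τ => ∏ p, betaB (τ p) (δ p) := funext fun τ => K₁pre_eq δ τ
  rw [hf, K₁red_eq]
  exact ⟨contourIntegrable_prod_betaB D.mem_pairGroup_iff hρ hsep.inStrip_pair,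
    contourIntegral_prod_betaB D.mem_pairGroup_iff hρ hsep.inStrip_pair⟩

end OneLoopDiagram

/-! ### Unimodular changes of variables -/

section Unimodular

/-- The real numbers that are integers. -/
abbrev realInts : Subring ℝ := (Int.castRingHom ℝ).range

theorem exists_det_eq_intCast {A : Type*} [Fintype A] {f : (A → ℝ) →ₗ[ℝ] (A → ℝ)}
    (hf : ∀ x, (∀ a, x a ∈ realInts) → ∀ a, f x a ∈ realInts) :
    ∃ m : ℤ, LinearMap.det f = m := by
  classical
  have h : ∀ i j, ∃ m : ℤ, LinearMap.toMatrix' f i j = m := by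
    intro i j
    rw [LinearMap.toMatrix'_apply]
    obtain ⟨m, hm⟩ := hf (Pi.single j 1) (fun a => by
      rw [Pi.single_apply]
      split_ifs
      · exact one_mem _
      · exact zero_mem _) i
    exact ⟨m, hm.symm⟩
  choose M hM using h
  refine ⟨(Matrix.of M).det, ?_⟩
  rw [← LinearMap.det_toMatrix', Int.cast_det]
  congr 1
  ext i j
  exact hM i j

/-- The map and its inverse have integer determinants with product one, so both are `±1`. The index
types have equal size by dimension, and any bijection between them turns the map into an
endomorphism with a determinant. -/
theorem measurePreserving_of_unimodular {A B : Type*} [Fintype A] [Fintype B]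
    (e : (A → ℝ) ≃ₗ[ℝ] (B → ℝ)) (he : ∀ x, (∀ a, x a ∈ realInts) → ∀ b, e x b ∈ realInts)
    (he' : ∀ x, (∀ b, x b ∈ realInts) → ∀ a, e.symm x a ∈ realInts) :
    MeasurePreserving e volume volume := by
  classical
  have hcard : Fintype.card A = Fintype.card B := by
    simpa using e.finrank_eq
  let σ : A ≃ B := Fintype.equivOfCardEq hcard
  let g : (B → ℝ) ≃ₗ[ℝ] (A → ℝ) := LinearEquiv.funCongrLeft ℝ ℝ σ
  let f : (A → ℝ) ≃ₗ[ℝ] (A → ℝ) := e.trans g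
  have hf : ∀ x, (∀ a, x a ∈ realInts) → ∀ a, f x a ∈ realInts := fun x hx a => he x hx (σ a)
  have hf' : ∀ x, (∀ a, x a ∈ realInts) → ∀ a, f.symm x a ∈ realInts := fun x hx a =>
    he' _ (fun b => hx (σ.symm b)) a
  obtain ⟨m, hm⟩ := exists_det_eq_intCast (f := (f : (A → ℝ) →ₗ[ℝ] (A → ℝ))) hf
  obtain ⟨m', hm'⟩ := exists_det_eq_intCast (f := (f.symm : (A → ℝ) →ₗ[ℝ] (A → ℝ))) hf'
  have hmul : (m : ℝ) * m' = 1 := by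
    rw [← hm, ← hm']
    exact f.det_mul_det_symm
  have hmul' : m * m' = 1 := by exact_mod_cast hmul
  have habs : |(m : ℝ)⁻¹| = 1 := by
    rcases Int.eq_one_or_neg_one_of_mul_eq_one hmul' with h | h <;> simp [h]
  have hm0 : LinearMap.det (f : (A → ℝ) →ₗ[ℝ] (A → ℝ)) ≠ 0 := by
    rw [hm]
    exact left_ne_zero_of_mul_eq_one hmul
  have hmap := Real.map_linearMap_volume_pi_eq_smul_volume_pi hm0
  rw [hm, habs, ENNReal.ofReal_one, one_smul] at hmap
  have hfp : MeasurePreserving f volume volume :=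
    ⟨(LinearMap.continuous_on_pi (f : (A → ℝ) →ₗ[ℝ] (A → ℝ))).measurable, hmap⟩
  have hg := volume_measurePreserving_piCongrLeft (fun _ : B => ℝ) σ
  have hcomp : (e : (A → ℝ) → (B → ℝ)) = MeasurableEquiv.piCongrLeft (fun _ : B => ℝ) σ ∘ f := by
    ext x b
    obtain ⟨a, rfl⟩ := σ.surjective b
    simp only [Function.comp_apply, MeasurableEquiv.coe_piCongrLeft, Equiv.piCongrLeft_apply_apply]
    rfl
  rw [hcomp]
  exact hg.comp hfp

theorem measurePreserving_prod_of_unimodular {A A' B B' B'' : Type*} [Fintype A] [Fintype A']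
    [Fintype B] [Fintype B'] [Fintype B'']
    (e : ((A → ℝ) × (A' → ℝ)) ≃ₗ[ℝ] ((B → ℝ) × (B' → ℝ) × (B'' → ℝ)))
    (he : ∀ x : (A → ℝ) × (A' → ℝ), (∀ a, x.1 a ∈ realInts) → (∀ a, x.2 a ∈ realInts) →
      (∀ b, (e x).1 b ∈ realInts) ∧ (∀ b, (e x).2.1 b ∈ realInts) ∧
        ∀ b, (e x).2.2 b ∈ realInts)
    (he' : ∀ x : (B → ℝ) × (B' → ℝ) × (B'' → ℝ), (∀ b, x.1 b ∈ realInts) →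
      (∀ b, x.2.1 b ∈ realInts) → (∀ b, x.2.2 b ∈ realInts) →
      (∀ a, (e.symm x).1 a ∈ realInts) ∧ ∀ a, (e.symm x).2 a ∈ realInts) :
    MeasurePreserving e volume volume := by
  let eA : (A ⊕ A' → ℝ) ≃ₗ[ℝ] (A → ℝ) × (A' → ℝ) := LinearEquiv.sumArrowLequivProdArrow A A' ℝ ℝ
  let eB : (B ⊕ (B' ⊕ B'') → ℝ) ≃ₗ[ℝ] (B → ℝ) × (B' → ℝ) × (B'' → ℝ) :=
    (LinearEquiv.sumArrowLequivProdArrow B (B' ⊕ B'') ℝ ℝ).trans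
      (LinearEquiv.prodCongr (LinearEquiv.refl ℝ _) (LinearEquiv.sumArrowLequivProdArrow B' B'' ℝ ℝ))
  have hA : MeasurePreserving eA.symm volume volume :=
    volume_measurePreserving_sumPiEquivProdPi_symm fun _ : A ⊕ A' => ℝ
  have hB : MeasurePreserving eB volume volume :=
    ((MeasurePreserving.id (volume : Measure (B → ℝ))).prod
      (volume_measurePreserving_sumPiEquivProdPi fun _ : B' ⊕ B'' => ℝ)).comp
      (volume_measurePreserving_sumPiEquivProdPi fun _ : B ⊕ (B' ⊕ B'') => ℝ)
  have hmid : MeasurePreserving (eA.trans (e.trans eB.symm)) volume volume := by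
    refine measurePreserving_of_unimodular _ (fun x hx => ?_) (fun x hx => ?_)
    · have h := he (eA x) (fun a => hx (Sum.inl a)) (fun a => hx (Sum.inr a))
      rintro (b | b | b)
      · exact h.1 b
      · exact h.2.1 b
      · exact h.2.2 b
    · have h := he' (eB x) (fun b => hx (Sum.inl b)) (fun b => hx (Sum.inr (Sum.inl b)))
        (fun b => hx (Sum.inr (Sum.inr b)))
      rintro (a | a)
      · exact h.1 a
      · exact h.2 a
  have hcomp : (e : _ → _) = eB ∘ (eA.trans (e.trans eB.symm)) ∘ eA.symm := by
    ext1 x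
    simp
  rw [hcomp]
  exact hB.comp (hmid.comp hA)

/-! ### Integration over the fibres of a linear change of variables -/

theorem measurable_linearMap_prod {A A' B B' B'' : Type*} [Fintype A] [Fintype A'] [Fintype B]
    [Fintype B'] [Fintype B'']
    (f : ((B → ℝ) × (B' → ℝ) × (B'' → ℝ)) →ₗ[ℝ] ((A → ℝ) × (A' → ℝ))) : Measurable f :=
  f.continuous_of_finiteDimensional.measurable

/-- Integration of a function over the fibres of a volume preserving linear change of variables,
followed by a rescaling of the remaining variables by `-2`. -/
theorem integral_eq_of_fibre {A A' B B' B'' : Type*} [Fintype A] [Fintype A'] [Fintype B]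
    [Fintype B'] [Fintype B'']
    (e : ((A → ℝ) × (A' → ℝ)) ≃ₗ[ℝ] ((B → ℝ) × (B' → ℝ) × (B'' → ℝ)))
    (he : MeasurePreserving e volume volume) {F : (A → ℝ) × (A' → ℝ) → ℂ} {R : (B → ℝ) → ℂ}
    {K : ℂ} (hK : K ≠ 0) (hF : Integrable F)
    (hfib : ∀ q, Integrable (fun w => F (e.symm (q, w))) →
      ∫ w, F (e.symm (q, w)) = K * R ((-2 : ℝ) • q)) :
    Integrable R ∧ ∫ y, F y = K * ((1 / 2 : ℂ) ^ Fintype.card B * ∫ t, R t) := by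
  let em : ((A → ℝ) × (A' → ℝ)) ≃ᵐ ((B → ℝ) × (B' → ℝ) × (B'' → ℝ)) :=
    { e.toEquiv with
      measurable_toFun := he.measurable
      measurable_invFun := measurable_linearMap_prod e.symm.toLinearMap }
  have hem : MeasurePreserving em volume volume := he
  have hsymm : MeasurePreserving em.symm volume volume := hem.symm
  have hint : Integrable (fun x => F (e.symm x)) ((volume : Measure (B → ℝ)).prod volume) :=
    (hsymm.integrable_comp_emb em.symm.measurableEmbedding).2 hF
  -- Fubini makes almost every fibre integrable, which is all that the hypothesis on fibres
  -- requires.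
  have hae : ∀ᵐ q : B → ℝ, ∫ w, F (e.symm (q, w)) = K * R ((-2 : ℝ) • q) := by
    filter_upwards [hint.prod_right_ae] with q hq
    exact hfib q hq
  constructor
  · rw [← integrable_comp_smul_iff volume R (by norm_num : (-2 : ℝ) ≠ 0)]
    refine ((hint.integral_prod_left.congr hae).const_mul K⁻¹).congr
      (Eventually.of_forall fun q => ?_)
    simp only
    rw [← mul_assoc, inv_mul_cancel₀ hK, one_mul]
  · have hF' : ∫ y, F y = ∫ x, F (e.symm x) :=
      (hsymm.integral_comp em.symm.measurableEmbedding F).symm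
    -- The dilation by `-2` enters through its absolute Jacobian, so the sign disappears and `1/2`
    -- per coordinate remains.
    rw [hF', Measure.volume_eq_prod, integral_prod _ hint, integral_congr_ae hae,
      integral_const_mul, Measure.integral_comp_smul, Module.finrank_fintype_fun_eq_card,
      Complex.real_smul, abs_inv, abs_pow, abs_neg, abs_two]
    push_cast
    rw [one_div, inv_pow]

end Unimodular

/-! ### Displacements with prescribed group sums -/

section Fill

variable {J G : Type*} [Fintype J] {grp : G → Finset J} {piv : G → J} {γ : J → G}

theorem shift_add (y y' : FreeVar piv → ℝ) :
    shift grp piv (y + y') = shift grp piv y + shift grp piv y' := by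
  ext j
  simp only [shift, Pi.add_apply]
  split_ifs with h
  · rfl
  · rw [← neg_add, ← Finset.sum_add_distrib]
    congr 1
    refine Finset.sum_congr rfl fun q _ => ?_
    split_ifs <;> simp

theorem shift_smul (a : ℝ) (y : FreeVar piv → ℝ) :
    shift grp piv (a • y) = a • shift grp piv y := by
  ext j
  simp only [shift, Pi.smul_apply, smul_eq_mul]
  split_ifs with h
  · rfl
  · rw [mul_neg, Finset.mul_sum]
    congr 1
    refine Finset.sum_congr rfl fun q _ => ?_
    split_ifs <;> simp

theorem shift_zero : shift grp piv 0 = 0 := by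
  simpa using shift_smul (grp := grp) (piv := piv) 0 0

theorem shift_mem_realInts {y : FreeVar piv → ℝ} (hy : ∀ j, y j ∈ realInts) (j : J) :
    shift grp piv y j ∈ realInts := by
  rw [shift]
  split_ifs with h
  · exact hy _
  · refine neg_mem (sum_mem fun q _ => ?_)
    split_ifs
    · exact hy q
    · exact zero_mem _

variable [Fintype G]

open Classical in
/-- The displacement of all variables for which the displacements of the free ones are `y` and the
sums over the groups are `σ`. -/
noncomputable def fill (grp : G → Finset J) (piv : G → J) (σ : G → ℝ) (y : FreeVar piv → ℝ) (j : J) :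
    ℝ :=
  shift grp piv y j + ∑ g, if piv g = j then σ g else 0

theorem fill_free (σ : G → ℝ) (y : FreeVar piv → ℝ) (j : FreeVar piv) :
    fill grp piv σ y j = y j := by
  rw [fill, shift_of_free, Finset.sum_eq_zero fun g _ => if_neg (j.2 g).symm, add_zero]

theorem fill_mem_realInts {σ : G → ℝ} {y : FreeVar piv → ℝ} (hσ : ∀ g, σ g ∈ realInts)
    (hy : ∀ j, y j ∈ realInts) (j : J) : fill grp piv σ y j ∈ realInts := by
  refine add_mem (shift_mem_realInts hy j) (sum_mem fun g _ => ?_)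
  split_ifs
  · exact hσ g
  · exact zero_mem _

theorem contourPoint_fill (z₀ : J → ℂ) (σ : G → ℝ) (y : FreeVar piv → ℝ) :
    contourPoint grp piv (fun j => z₀ j + Complex.I * (fill grp piv σ 0 j : ℂ)) y =
      fun j => z₀ j + Complex.I * (fill grp piv σ y j : ℂ) := by
  ext j
  simp only [contourPoint, fill, shift_zero, Pi.zero_apply, zero_add]
  push_cast
  ring

variable (hγ : ∀ g j, j ∈ grp g ↔ γ j = g) (hpiv : ∀ g, piv g ∈ grp g)
include hγ hpiv

theorem sum_fill (σ : G → ℝ) (y : FreeVar piv → ℝ) (g : G) :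
    ∑ j ∈ grp g, fill grp piv σ y j = σ g := by
  classical
  rw [sum_group_eq hγ hpiv]
  simp only [fill_free]
  rw [fill, shift_pivot hγ hpiv, Finset.sum_eq_single g]
  · simp
  · intro g' _ hg'
    exact if_neg fun h => hg' (pivot_injective hγ hpiv h)
  · simp

/-- Once the free members are known, a group sum determines the displacement of its pivot. -/
theorem eq_fill {σ : G → ℝ} {y : FreeVar piv → ℝ} {d : J → ℝ} (hd : ∀ j : FreeVar piv, d j = y j)
    (hσ : ∀ g, ∑ j ∈ grp g, d j = σ g) : d = fill grp piv σ y := by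
  classical
  ext j
  by_cases hj : ∀ g, j ≠ piv g
  · exact (hd ⟨j, hj⟩).trans (fill_free σ y ⟨j, hj⟩).symm
  · push Not at hj
    obtain ⟨g, rfl⟩ := hj
    have h := (hσ g).trans (sum_fill hγ hpiv σ y g).symm
    rw [sum_group_eq hγ hpiv, sum_group_eq hγ hpiv] at h
    simpa only [hd, fill_free, add_left_inj] using h

theorem sum_shift (y : FreeVar piv → ℝ) (g : G) : ∑ j ∈ grp g, shift grp piv y j = 0 := by
  have h := sum_fill hγ hpiv 0 y g
  simpa [fill] using h

theorem eq_shift {y : FreeVar piv → ℝ} {d : J → ℝ} (hd : ∀ j : FreeVar piv, d j = y j)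
    (hσ : ∀ g, ∑ j ∈ grp g, d j = 0) : d = shift grp piv y := by
  have h := eq_fill hγ hpiv (σ := 0) hd hσ
  rw [h]
  ext j
  simp [fill]

end Fill

namespace OneLoopDiagram

variable {n r : ℕ} {V : Type*} [Fintype V] (D : OneLoopDiagram n r V)

/-! ### The channels of the independent Mandelstam variables -/

theorem mem_channels_chain {a : ℕ} : Sum.inl a ∈ D.channels ↔ 2 ≤ a ∧ a ≤ r := by
  simp [channels]

theorem mem_channels_loop {a b : ℕ} : Sum.inr (Sum.inl (a, b)) ∈ D.channels ↔
    ((1 ≤ a ∧ a ≤ r) ∧ 1 ≤ b ∧ b ≤ r) ∧ a ≤ b ∧ ¬ (a = 1 ∧ b = r) ∧ 2 ≤ (D.segPts a b).card := by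
  simp [channels]

theorem mem_channels_branch {v : V} : Sum.inr (Sum.inr v) ∈ D.channels ↔
    ∃ w, D.parent v = some w ∧ ¬ D.TrivalentOnLoop w := by
  simp [channels]

/-- Such a vertex is on the loop, or is a child of a trivalent loop vertex and carries all of its
points. That parent cannot instead have a single point, because the branch of a vertex off the loop
contains at least two. -/
theorem branchPts_of_notMem_channels {v : V} (hv : Sum.inr (Sum.inr v) ∉ D.channels) :
    D.branchPts v = D.segPts (D.pos v) (D.pos v) := by
  rw [mem_channels_branch] at hv
  push Not at hv
  cases hp : D.parent v with
  | none => exact D.branchPts_root hp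
  | some w =>
    have hw := hv w hp
    have hvc : v ∈ D.children w := D.mem_children.2 hp
    rcases hw.cases with ⟨c, hc, hcb⟩ | h1
    · rw [hc, Finset.mem_singleton] at hvc
      rw [hvc, ← hcb, D.branchPts_root hw.1, ← hvc, D.pos_parent v w hp]
    · have h2 := D.two_le_card_branchPts (D.not_trivalentOnLoop_of_parent hp)
      have h3 := Finset.card_le_card (D.branchPts_child_subset hvc)
      omega

section Coordinates

variable {R : Type*} [CommRing R]

/-- The sums `∑_{i<j} τ_ij` and `∑_{i<j} τ_ij + ∑ τ_{k,n+1}` in terms of which the Mandelstam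
variables of the independent channels are displaced. -/
noncomputable def chanCoord (τ : BPair n → R) (u : Fin n → R) (x : D.Chan) : R :=
  match x.1 with
  | Sum.inl a => pairsIn τ (D.segPts a r) + ∑ k ∈ D.segPts a r, u k
  | Sum.inr (Sum.inl y) => pairsIn τ (D.segPts y.1 y.2)
  | Sum.inr (Sum.inr v) => pairsIn τ (D.branchPts v)

open Classical in
/-- The coordinates of all the chain channels. -/
noncomputable def chainExt (q : D.Chan → R) (a : ℕ) : R :=
  if ha : Sum.inl a ∈ D.channels then q ⟨_, ha⟩ else 0

open Classical in
/-- The coordinates of all the loop channels. -/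
noncomputable def loopExt (q : D.Chan → R) (a b : ℕ) : R :=
  if hab : Sum.inr (Sum.inl (a, b)) ∈ D.channels then q ⟨_, hab⟩ else 0

open Classical in
/-- The coordinates of all the tree channels. -/
noncomputable def branchExt (q : D.Chan → R) (v : V) : R :=
  if hv : Sum.inr (Sum.inr v) ∈ D.channels then q ⟨_, hv⟩ else D.loopExt q (D.pos v) (D.pos v)

/-- The sums over the groups of the `τ_ij`, from the coordinates of the channels. -/
noncomputable def pairSums (q : D.Chan → R) : D.PairGroup → R
  | Sum.inl x => D.loopExt q x.1.1 x.1.2 - D.loopExt q x.1.1 (x.1.2 - 1) -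
      D.loopExt q (x.1.1 + 1) x.1.2 + D.loopExt q (x.1.1 + 1) (x.1.2 - 1)
  | Sum.inr v => D.branchExt q v - ∑ c ∈ D.children v, D.branchExt q c

/-- The sums over the groups of the `τ_{k,n+1}`, from the coordinates of the channels. -/
noncomputable def lastSums (q : D.Chan → R) (a : {a : ℕ // 1 ≤ a ∧ a ≤ r}) : R :=
  (D.chainExt q a - D.chainExt q (a + 1)) - (D.loopExt q a r - D.loopExt q (a + 1) r)

theorem loopExt_of_lt (q : D.Chan → R) {a b : ℕ} (h : b < a) : D.loopExt q a b = 0 := by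
  rw [loopExt, dif_neg]
  rw [mem_channels_loop]
  omega

theorem loopExt_one_r (q : D.Chan → R) : D.loopExt q 1 r = 0 := by
  rw [loopExt, dif_neg]
  rw [mem_channels_loop]
  tauto

/-! ### From displacements to channel coordinates and group sums -/

section Recover

variable {τ : BPair n → R} {u : Fin n → R}

/-- The default value `0` is correct for every omitted channel: an empty segment, a segment with one
point, or the whole loop, where the total displacement vanishes. -/
theorem loopExt_chanCoord (hτ : ∑ p, τ p = 0) {a b : ℕ} (ha : 1 ≤ a) (hb : b ≤ r) :
    D.loopExt (D.chanCoord τ u) a b = pairsIn τ (D.segPts a b) := by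
  rw [loopExt]
  split_ifs with h
  · rfl
  · rw [mem_channels_loop] at h
    by_cases hab : b < a
    · rw [D.segPts_of_lt hab]
      simp [pairsIn]
    · by_cases h1 : a = 1 ∧ b = r
      · rw [h1.1, h1.2, segPts_one_r, pairsIn_univ, hτ]
      · rw [pairsIn_eq_zero_of_card_lt_two]
        by_contra hc
        exact h ⟨⟨⟨ha, by omega⟩, by omega, hb⟩, by omega, h1, by omega⟩

theorem branchExt_chanCoord (hτ : ∑ p, τ p = 0) (v : V) :
    D.branchExt (D.chanCoord τ u) v = pairsIn τ (D.branchPts v) := by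
  rw [branchExt]
  split_ifs with h
  · rfl
  · rw [D.branchPts_of_notMem_channels h,
      D.loopExt_chanCoord hτ (D.pos_mem_Icc v).1 (D.pos_mem_Icc v).2]

theorem chainExt_chanCoord (hτ : ∑ p, τ p = 0) (hu : ∑ k, u k = 0) {a : ℕ} (h1 : 1 ≤ a) :
    D.chainExt (D.chanCoord τ u) a =
      pairsIn τ (D.segPts a r) + ∑ k ∈ D.segPts a r, u k := by
  rw [chainExt]
  split_ifs with h
  · rfl
  · rw [mem_channels_chain] at h
    by_cases ha : a = 1
    · rw [ha, segPts_one_r, pairsIn_univ, hτ, hu, add_zero]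
    · rw [D.segPts_of_lt (by omega)]
      simp [pairsIn]

theorem pairSums_chanCoord (hτ : ∑ p, τ p = 0) (g : D.PairGroup) :
    D.pairSums (D.chanCoord τ u) g = ∑ p ∈ D.pairGroup g, τ p := by
  rcases g with x | v
  · have hx := x.2
    rw [sum_pairGroup_inl, pairSums, D.loopExt_chanCoord hτ, D.loopExt_chanCoord hτ,
      D.loopExt_chanCoord hτ, D.loopExt_chanCoord hτ] <;> omega
  · rw [sum_pairGroup_inr, pairSums]
    simp only [D.branchExt_chanCoord hτ]

theorem lastSums_chanCoord (hτ : ∑ p, τ p = 0) (hu : ∑ k, u k = 0)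
    (a : {a : ℕ // 1 ≤ a ∧ a ≤ r}) :
    D.lastSums (D.chanCoord τ u) a = ∑ k ∈ D.lastGroup a, u k := by
  have ha := a.2
  rw [lastGroup, D.sum_segPts_self u ha.2, lastSums, D.chainExt_chanCoord hτ hu ha.1,
    D.chainExt_chanCoord hτ hu (by omega), D.loopExt_chanCoord hτ ha.1 le_rfl,
    D.loopExt_chanCoord hτ (by omega) le_rfl]
  ring

end Recover

/-! ### From group sums back to channel coordinates -/

section Prescribe

variable {q : D.Chan → R} {τ : BPair n → R} {u : Fin n → R}

/-- Induction from the tips inwards: the group of `v` gives its branch from those of its children. A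
trivalent loop vertex has no group, but it inherits the value of its only child, or has a single
point and value zero. -/
theorem pairsIn_branchPts_of_pairSums (hτ : ∀ g, ∑ p ∈ D.pairGroup g, τ p = D.pairSums q g) (v : V) :
    pairsIn τ (D.branchPts v) = D.branchExt q v := by
  induction v using D.wf_children.induction with
  | h v ih =>
    by_cases hv : D.TrivalentOnLoop v
    · have hvc : Sum.inr (Sum.inr v) ∉ D.channels := by
        rw [mem_channels_branch]
        rintro ⟨w, hw, -⟩
        simp [hv.1] at hw
      rw [branchExt, dif_neg hvc]
      rcases hv.cases with ⟨c, hc, hcb⟩ | h1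
      · have hcv : D.parent c = some v := D.mem_children.1 (by simp [hc])
        rw [hcb, ih c hcv, branchExt, dif_neg, D.pos_parent c v hcv]
        rw [mem_channels_branch]
        rintro ⟨w, hw, hwt⟩
        rw [hcv] at hw
        exact hwt (Option.some_injective _ hw ▸ hv)
      · rw [pairsIn_eq_zero_of_card_lt_two _ (by omega), loopExt, dif_neg]
        rw [mem_channels_loop, ← D.branchPts_root hv.1]
        omega
    · have h := hτ (Sum.inr ⟨v, hv⟩)
      rw [sum_pairGroup_inr, pairSums] at h
      simp only at h
      rw [Finset.sum_congr rfl fun c hc => ih c (D.mem_children.1 hc)] at h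
      exact sub_left_injective h

/-- Induction on the length: a cross group expresses a segment through three shorter ones, and a
segment of length one is the branch of a loop vertex. -/
theorem pairsIn_segPts_of_pairSums (hτ : ∀ g, ∑ p ∈ D.pairGroup g, τ p = D.pairSums q g) {a b : ℕ}
    (ha : 1 ≤ a) (hb : b ≤ r) : pairsIn τ (D.segPts a b) = D.loopExt q a b := by
  induction hd : b + 1 - a using Nat.strong_induction_on generalizing a b with
  | _ d ih =>
    rcases lt_trichotomy a b with hab | hab | hab
    · have h := hτ (Sum.inl ⟨(a, b), ha, hab, hb⟩)
      rw [sum_pairGroup_inl, pairSums] at h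
      simp only at h
      rw [ih _ (by omega) ha (by omega : b - 1 ≤ r) rfl,
        ih _ (by omega) (by omega : 1 ≤ a + 1) hb rfl,
        ih _ (by omega) (by omega : 1 ≤ a + 1) (by omega : b - 1 ≤ r) rfl] at h
      linear_combination h
    · subst hab
      obtain ⟨v, hv, rfl⟩ := D.exists_root_pos ha hb
      rw [← D.branchPts_root hv, D.pairsIn_branchPts_of_pairSums hτ, branchExt, dif_neg]
      rw [mem_channels_branch]
      rintro ⟨w, hw, -⟩
      simp [hv] at hw
    · rw [D.loopExt_of_lt q hab, D.segPts_of_lt hab]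
      simp [pairsIn]

theorem sum_eq_zero_of_pairSums (hτ : ∀ g, ∑ p ∈ D.pairGroup g, τ p = D.pairSums q g) :
    ∑ p, τ p = 0 := by
  rw [← pairsIn_univ, ← D.segPts_one_r, D.pairsIn_segPts_of_pairSums hτ le_rfl le_rfl,
    loopExt_one_r]

/-- Telescoping downwards from the empty segment beyond `r`. -/
theorem sum_segPts_of_lastSums (hu : ∀ a, ∑ k ∈ D.lastGroup a, u k = D.lastSums q a) {a : ℕ}
    (ha : 1 ≤ a) : ∑ k ∈ D.segPts a r, u k = D.chainExt q a - D.loopExt q a r := by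
  induction hd : r + 1 - a generalizing a with
  | zero =>
    rw [D.segPts_of_lt (by omega), D.loopExt_of_lt q (by omega), chainExt, dif_neg]
    · simp
    · rw [mem_channels_chain]
      omega
  | succ d ih =>
    have h := hu ⟨a, ha, by omega⟩
    rw [lastGroup, D.sum_segPts_self u (by simp only; omega), lastSums] at h
    simp only at h
    rw [ih (a := a + 1) (by omega) (by omega)] at h
    linear_combination h

theorem sum_eq_zero_of_lastSums (hu : ∀ a, ∑ k ∈ D.lastGroup a, u k = D.lastSums q a) :
    ∑ k, u k = 0 := by
  rw [← D.segPts_one_r, D.sum_segPts_of_lastSums hu le_rfl, loopExt_one_r, chainExt, dif_neg,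
    sub_zero]
  rw [mem_channels_chain]
  omega

theorem chanCoord_of_sums (hτ : ∀ g, ∑ p ∈ D.pairGroup g, τ p = D.pairSums q g)
    (hu : ∀ a, ∑ k ∈ D.lastGroup a, u k = D.lastSums q a) : D.chanCoord τ u = q := by
  ext ⟨x, hx⟩
  rcases x with a | ⟨a, b⟩ | v
  · have ha := D.mem_channels_chain.1 hx
    simp only [chanCoord]
    rw [D.sum_segPts_of_lastSums hu (by omega), D.pairsIn_segPts_of_pairSums hτ (by omega) le_rfl,
      chainExt, dif_pos hx]
    ring
  · have hab := D.mem_channels_loop.1 hx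
    simp only [chanCoord]
    rw [D.pairsIn_segPts_of_pairSums hτ hab.1.1.1 hab.1.2.2, loopExt, dif_pos hx]
  · simp only [chanCoord]
    rw [D.pairsIn_branchPts_of_pairSums hτ, branchExt, dif_pos hx]

end Prescribe

end Coordinates

/-! ### Integrality and linearity of the coordinates -/

theorem pairsIn_mem_realInts {τ : BPair n → ℝ} (hτ : ∀ p, τ p ∈ realInts) (S : Finset (Fin n)) :
    pairsIn τ S ∈ realInts := by
  refine sum_mem fun p _ => ?_
  split_ifs
  · exact hτ p
  · exact zero_mem _

theorem chanCoord_mem_realInts {τ : BPair n → ℝ} {u : Fin n → ℝ} (hτ : ∀ p, τ p ∈ realInts)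
    (hu : ∀ k, u k ∈ realInts) (x : D.Chan) : D.chanCoord τ u x ∈ realInts := by
  rcases x with ⟨a | y | v, hx⟩
  · exact add_mem (pairsIn_mem_realInts hτ _) (sum_mem fun k _ => hu k)
  · exact pairsIn_mem_realInts hτ _
  · exact pairsIn_mem_realInts hτ _

section

variable {q : D.Chan → ℝ} (hq : ∀ x, q x ∈ realInts)
include hq

theorem chainExt_mem_realInts (a : ℕ) : D.chainExt q a ∈ realInts := by
  rw [chainExt]
  split_ifs
  · exact hq _
  · exact zero_mem _

theorem loopExt_mem_realInts (a b : ℕ) : D.loopExt q a b ∈ realInts := by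
  rw [loopExt]
  split_ifs
  · exact hq _
  · exact zero_mem _

theorem branchExt_mem_realInts (v : V) : D.branchExt q v ∈ realInts := by
  rw [branchExt]
  split_ifs
  · exact hq _
  · exact D.loopExt_mem_realInts hq _ _

theorem pairSums_mem_realInts (g : D.PairGroup) : D.pairSums q g ∈ realInts := by
  rcases g with x | v
  · exact add_mem (sub_mem (sub_mem (D.loopExt_mem_realInts hq _ _) (D.loopExt_mem_realInts hq _ _))
      (D.loopExt_mem_realInts hq _ _)) (D.loopExt_mem_realInts hq _ _)
  · exact sub_mem (D.branchExt_mem_realInts hq _) (sum_mem fun c _ => D.branchExt_mem_realInts hq c)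

theorem lastSums_mem_realInts (a : {a : ℕ // 1 ≤ a ∧ a ≤ r}) : D.lastSums q a ∈ realInts :=
  sub_mem (sub_mem (D.chainExt_mem_realInts hq _) (D.chainExt_mem_realInts hq _))
    (sub_mem (D.loopExt_mem_realInts hq _ _) (D.loopExt_mem_realInts hq _ _))

end

theorem pairsIn_add (τ τ' : BPair n → ℝ) (S : Finset (Fin n)) :
    pairsIn (τ + τ') S = pairsIn τ S + pairsIn τ' S := by
  simp only [pairsIn, ← Finset.sum_add_distrib]
  refine Finset.sum_congr rfl fun p _ => ?_
  split_ifs <;> simp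

theorem pairsIn_smul (a : ℝ) (τ : BPair n → ℝ) (S : Finset (Fin n)) :
    pairsIn (a • τ) S = a * pairsIn τ S := by
  simp only [pairsIn, Finset.mul_sum]
  refine Finset.sum_congr rfl fun p _ => ?_
  split_ifs <;> simp

theorem chanCoord_add (τ τ' : BPair n → ℝ) (u u' : Fin n → ℝ) :
    D.chanCoord (τ + τ') (u + u') = D.chanCoord τ u + D.chanCoord τ' u' := by
  ext ⟨a | y | v, hx⟩
  · simp only [chanCoord, Pi.add_apply, pairsIn_add, Finset.sum_add_distrib]
    ring
  · exact pairsIn_add _ _ _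
  · exact pairsIn_add _ _ _

theorem chanCoord_smul (a : ℝ) (τ : BPair n → ℝ) (u : Fin n → ℝ) :
    D.chanCoord (a • τ) (a • u) = a • D.chanCoord τ u := by
  ext ⟨b | y | v, hx⟩
  · simp only [chanCoord, Pi.smul_apply, pairsIn_smul, smul_eq_mul, ← Finset.mul_sum]
    ring
  · exact pairsIn_smul _ _ _
  · exact pairsIn_smul _ _ _

/-! ### The change of variables -/

section ChangeOfVariables

variable (p₀ : BPair n) (k₀ : Fin n) {ρ : D.PairGroup → BPair n} (hρ : ∀ g, ρ g ∈ D.pairGroup g)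
  {κ : {a : ℕ // 1 ≤ a ∧ a ≤ r} → Fin n} (hκ : ∀ a, κ a ∈ D.lastGroup a)

/-- The contour of the pre-amplitude is the case of a single group containing all variables, with
one pivot, so the group lemmas apply to it. -/
theorem mem_univ_iff_unit {J : Type*} [Fintype J] (g : Unit) (j : J) :
    j ∈ (fun _ : Unit => (Finset.univ : Finset J)) g ↔ (fun _ : J => ()) j = g := by simp

/-- The change of variables from all Mellin variables but two to the channel coordinates and the
variables that are free within the groups. -/
noncomputable def mandelstamEquiv :
    ((FreeVar (fun _ : Unit => p₀) → ℝ) × (FreeVar (fun _ : Unit => k₀) → ℝ)) ≃ₗ[ℝ]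
      ((D.Chan → ℝ) × (FreeVar ρ → ℝ) × (FreeVar κ → ℝ)) where
  toFun y :=
    let τ := shift (fun _ : Unit => Finset.univ) (fun _ => p₀) y.1
    let u := shift (fun _ : Unit => Finset.univ) (fun _ => k₀) y.2
    (D.chanCoord τ u, fun j => τ j, fun k => u k)
  invFun x := (fun j => fill D.pairGroup ρ (D.pairSums x.1) x.2.1 j,
    fun k => fill D.lastGroup κ (D.lastSums x.1) x.2.2 k)
  map_add' y y' := by
    simp only [Prod.fst_add, Prod.snd_add, shift_add, chanCoord_add]
    rfl
  map_smul' a y := by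
    simp only [Prod.smul_fst, Prod.smul_snd, shift_smul, chanCoord_smul]
    rfl
  left_inv y := by
    -- The vanishing totals are what make the omitted channels carry coordinate zero, so that the
    -- group sums can be recovered.
    have hτ := sum_shift (piv := fun _ : Unit => p₀) mem_univ_iff_unit
      (fun _ => Finset.mem_univ _) y.1 ()
    have hu := sum_shift (piv := fun _ : Unit => k₀) mem_univ_iff_unit
      (fun _ => Finset.mem_univ _) y.2 ()
    ext j
    · simp only
      rw [← eq_fill D.mem_pairGroup_iff hρ (fun _ => rfl)
        fun g => (D.pairSums_chanCoord hτ g).symm, shift_of_free]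
    · simp only
      rw [← eq_fill D.mem_lastGroup_iff hκ (fun _ => rfl)
        fun a => (D.lastSums_chanCoord hτ hu a).symm, shift_of_free]
  right_inv x := by
    have hτ := sum_fill D.mem_pairGroup_iff hρ (D.pairSums x.1) x.2.1
    have hu := sum_fill D.mem_lastGroup_iff hκ (D.lastSums x.1) x.2.2
    simp only
    -- Group sums that come from channel coordinates add up to zero overall, so the omitted pivots
    -- `p₀` and `k₀` take the values required by the one-group contour.
    rw [← eq_shift (piv := fun _ : Unit => p₀) mem_univ_iff_unit (fun _ => Finset.mem_univ _)
        (fun _ => rfl) fun _ => D.sum_eq_zero_of_pairSums hτ,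
      ← eq_shift (piv := fun _ : Unit => k₀) mem_univ_iff_unit (fun _ => Finset.mem_univ _)
        (fun _ => rfl) fun _ => D.sum_eq_zero_of_lastSums hu, D.chanCoord_of_sums hτ hu]
    simp only [fill_free]

/-- In both directions the formulas involve only sums and differences with integer coefficients.
Keeping the factor `-2` out of the coordinates is what makes the map unimodular. -/
theorem measurePreserving_mandelstamEquiv :
    MeasurePreserving (D.mandelstamEquiv p₀ k₀ hρ hκ) volume volume := by
  refine measurePreserving_prod_of_unimodular _ (fun y h1 h2 => ⟨?_, ?_, ?_⟩)
    (fun x h1 h2 h3 => ⟨?_, ?_⟩)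
  · exact D.chanCoord_mem_realInts (shift_mem_realInts h1) (shift_mem_realInts h2)
  · exact fun j => shift_mem_realInts h1 j
  · exact fun k => shift_mem_realInts h2 k
  · exact fun j => fill_mem_realInts (D.pairSums_mem_realInts h1) h2 j
  · exact fun k => fill_mem_realInts (D.lastSums_mem_realInts h1) h3 k

include hρ hκ in
theorem card_freeVar_add_card_freeVar :
    Fintype.card (FreeVar (fun _ : Unit => p₀)) + Fintype.card (FreeVar (fun _ : Unit => k₀)) =
      Fintype.card D.Chan + (Fintype.card (FreeVar ρ) + Fintype.card (FreeVar κ)) := by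
  simpa using (D.mandelstamEquiv p₀ k₀ hρ hκ).finrank_eq

/-- The contour of all Mellin variables but two, in the new variables. -/
theorem contourPoint_mandelstamEquiv_symm (τ₀ : BPair n → ℂ) (u₀ : Fin n → ℂ)
    (x : (D.Chan → ℝ) × (FreeVar ρ → ℝ) × (FreeVar κ → ℝ)) :
    contourPoint (fun _ : Unit => Finset.univ) (fun _ => p₀) τ₀
        ((D.mandelstamEquiv p₀ k₀ hρ hκ).symm x).1 =
      (fun p => τ₀ p + Complex.I * (fill D.pairGroup ρ (D.pairSums x.1) x.2.1 p : ℂ)) ∧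
    contourPoint (fun _ : Unit => Finset.univ) (fun _ => k₀) u₀
        ((D.mandelstamEquiv p₀ k₀ hρ hκ).symm x).2 =
      fun k => u₀ k + Complex.I * (fill D.lastGroup κ (D.lastSums x.1) x.2.2 k : ℂ) := by
  have hτ := sum_fill D.mem_pairGroup_iff hρ (D.pairSums x.1) x.2.1
  have hu := sum_fill D.mem_lastGroup_iff hκ (D.lastSums x.1) x.2.2
  constructor
  · unfold contourPoint
    rw [eq_shift (piv := fun _ : Unit => p₀) mem_univ_iff_unit (fun _ => Finset.mem_univ _)
        (fun _ => rfl) fun _ => D.sum_eq_zero_of_pairSums hτ]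
    rfl
  · unfold contourPoint
    rw [eq_shift (piv := fun _ : Unit => k₀) mem_univ_iff_unit (fun _ => Finset.mem_univ _)
        (fun _ => rfl) fun _ => D.sum_eq_zero_of_lastSums hu]
    rfl

end ChangeOfVariables

end OneLoopDiagram

/-! ### Imaginary displacements of the Mellin variables -/

section Displacement

variable {n : ℕ} {Δ : Fin n → ℂ} {h : ℝ} {c : ℂ} {δ τ : BPair n → ℂ} {u : Fin n → ℂ}

theorem mandelstam_displace (dτ : BPair n → ℝ) (S : Finset (Fin n)) :
    mandelstam Δ (fun p => τ p + Complex.I * (dτ p : ℂ)) S =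
      mandelstam Δ τ S + Complex.I * ((-2 * pairsIn dτ S : ℝ) : ℂ) := by
  have e : pairsIn (fun p => τ p + Complex.I * (dτ p : ℂ)) S =
      pairsIn τ S + Complex.I * ((pairsIn dτ S : ℝ) : ℂ) := by
    rw [pairsIn, pairsIn, pairsIn, ofReal_sum_ite, Finset.mul_sum, ← Finset.sum_add_distrib]
    exact Finset.sum_congr rfl fun p _ => by split_ifs <;> simp
  rw [mandelstam_eq, mandelstam_eq, e]
  push_cast
  ring

theorem re_pairSumAt_displace (dτ : BPair n → ℝ) (k : Fin n) :
    (pairSumAt (fun p => τ p + Complex.I * (dτ p : ℂ)) k).re = (pairSumAt τ k).re := by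
  rw [pairSumAt, pairSumAt, Complex.re_sum, Complex.re_sum]
  exact Finset.sum_congr rfl fun p _ => by split_ifs <;> simp

theorem Separating.displace (hsep : Separating Δ δ τ u) (dτ : BPair n → ℝ) (du : Fin n → ℝ) :
    Separating Δ δ (fun p => τ p + Complex.I * (dτ p : ℂ))
      (fun k => u k + Complex.I * (du k : ℂ)) where
  pair_pos p := by simpa using hsep.pair_pos p
  pair_lt p := by simpa using hsep.pair_lt p
  last_pos k := by simpa using hsep.last_pos k
  zero_pos k := by
    have := hsep.zero_pos k
    rw [tauZero, Complex.sub_re, Complex.sub_re] at this ⊢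
    rw [re_pairSumAt_displace]
    simpa using this

theorem sum_sub_tauZero :
    ∑ k, (u k - tauZero Δ τ u k) = 2 * ∑ k, u k - ∑ k, Δ k + 2 * ∑ p, τ p := by
  rw [← sum_univ_pairSumAt, Finset.mul_sum, ← Finset.sum_sub_distrib, ← Finset.sum_add_distrib]
  refine Finset.sum_congr rfl fun k _ => ?_
  rw [tauZero]
  ring

/-- Both constraints involve `τ` and `u` only through their totals. -/
theorem TauConstraints.displace (hτ : TauConstraints Δ h c τ u) {dτ : BPair n → ℝ}
    {du : Fin n → ℝ} (hdτ : ∑ p, dτ p = 0) (hdu : ∑ k, du k = 0) :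
    TauConstraints Δ h c (fun p => τ p + Complex.I * (dτ p : ℂ))
      (fun k => u k + Complex.I * (du k : ℂ)) := by
  have h1 : ∑ p, (τ p + Complex.I * (dτ p : ℂ)) = ∑ p, τ p := by
    rw [Finset.sum_add_distrib, ← Finset.mul_sum, ← Complex.ofReal_sum, hdτ]
    simp
  have h2 : ∑ k, (u k + Complex.I * (du k : ℂ)) = ∑ k, u k := by
    rw [Finset.sum_add_distrib, ← Finset.mul_sum, ← Complex.ofReal_sum, hdu]
    simp
  constructor
  · rw [sum_sub_tauZero, h1, h2, ← sum_sub_tauZero]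
    exact hτ.spectral
  · rw [h1]
    exact hτ.total

theorem integral_contour_eq {J G : Type*} [Fintype J] {grp : G → Finset J} {piv : G → J}
    [Fintype (FreeVar piv)] (f : (J → ℂ) → ℂ) (z₀ : J → ℂ) :
    ∫ y : FreeVar piv → ℝ, f (contourPoint grp piv z₀ y) =
      (2 * Real.pi) ^ Fintype.card (FreeVar piv) * contourIntegral grp piv f z₀ := by
  have : (Real.pi : ℂ) ≠ 0 := by exact_mod_cast Real.pi_ne_zero
  rw [contourIntegral_eq, ← mul_assoc, ← mul_pow, one_div, mul_inv_cancel₀ (by simp [this]),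
    one_pow, one_mul]

end Displacement

namespace OneLoopDiagram

variable {n r : ℕ} {V : Type*} [Fintype V] (D : OneLoopDiagram n r V)
  {Δ : Fin n → ℂ} {h : ℝ} {c : ℂ} {δ τ : BPair n → ℂ} {u : Fin n → ℂ}

/-- The coordinates are normalised so that every channel, chain channels included, moves with the
same factor `-2`. -/
theorem indep_displace (dτ : BPair n → ℝ) (du : Fin n → ℝ) (x : D.Chan) :
    D.indep Δ h c (fun p => τ p + Complex.I * (dτ p : ℂ)) (fun k => u k + Complex.I * (du k : ℂ)) x =
      D.indep Δ h c τ u x + Complex.I * ((-2 * D.chanCoord dτ du x : ℝ) : ℂ) := by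
  rcases x with ⟨a | y | v, hx⟩
  · simp only [indep, chainMand, chanCoord, mandelstam_displace,
      Finset.sum_add_distrib, ← Finset.mul_sum]
    push_cast
    ring
  · exact mandelstam_displace _ _
  · exact mandelstam_displace _ _

/-! ### The reduced kernel in terms of the independent Mandelstam variables -/

section Recover

variable (hτ : TauConstraints Δ h c τ u)
include hτ

theorem mandelstam_univ_of_tauConstraints : mandelstam Δ τ Finset.univ = 2 * h := by
  rw [mandelstam_eq, pairsIn_univ, ← hτ.total]
  ring

theorem loopOf_indep {a b : ℕ} (ha : 1 ≤ a) (hb : b ≤ r) :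
    D.loopOf Δ h (D.indep Δ h c τ u) a b = D.loopMand Δ τ a b := by
  rw [loopOf]
  split_ifs with hab h1
  · rfl
  · rw [h1.1, h1.2, loopMand, segPts_one_r, mandelstam_univ_of_tauConstraints hτ]
  · rw [loopMand, mandelstam_eq, pairsIn_eq_zero_of_card_lt_two, mul_zero, sub_zero]
    rw [mem_channels_loop] at hab
    by_contra hc
    have hne : (D.segPts a b).Nonempty := Finset.card_pos.1 (by omega)
    obtain ⟨k, hk⟩ := hne
    rw [mem_segPts] at hk
    exact hab ⟨⟨⟨ha, by omega⟩, by omega, hb⟩, by omega, h1, by omega⟩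

theorem branchOf_indep (v : V) :
    D.branchOf Δ h (D.indep Δ h c τ u) v = D.branchMand Δ τ v := by
  rw [branchOf]
  split_ifs with hv
  · rfl
  · rw [D.loopOf_indep hτ (D.pos_mem_Icc v).1 (D.pos_mem_Icc v).2, branchMand,
      D.branchPts_of_notMem_channels hv, loopMand]

theorem chainOf_indep {a : ℕ} (h1 : 1 ≤ a) :
    D.chainOf h c (D.indep Δ h c τ u) a = D.chainMand Δ h c τ u a := by
  rw [chainOf]
  split_ifs with ha ha'
  · rfl
  · have hs := hτ.spectral
    have ht := hτ.total
    rw [sum_sub_tauZero] at hs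
    rw [ha', chainMand, segPts_one_r, mandelstam_univ_of_tauConstraints hτ]
    -- At `a = 1` the segment contains every point, and the two constraints together force the value
    -- `h - c`.
    linear_combination -hs + 2 * ht
  · rw [mem_channels_chain] at ha
    rw [chainMand, D.segPts_of_lt (by omega)]
    simp [mandelstam]

theorem K₂red_indep :
    K₂red (r := r) (D.chainOf h c (D.indep Δ h c τ u)) (D.loopOf Δ h (D.indep Δ h c τ u)) =
      K₂red (r := r) (D.chainMand Δ h c τ u) (D.loopMand Δ τ) := by
  refine Finset.prod_congr rfl fun a ha => ?_
  obtain ⟨h1, h2⟩ := Finset.mem_Icc.1 ha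
  have e1 := D.chainOf_indep hτ h1
  have e2 := D.chainOf_indep hτ (a := a + 1) (by omega)
  have e3 := D.loopOf_indep hτ h1 le_rfl
  have e4 := D.loopOf_indep hτ (a := a + 1) (by omega) le_rfl
  have e5 := D.loopOf_indep hτ (b := a - 1) le_rfl (by omega)
  have e6 := D.loopOf_indep hτ le_rfl h2
  rw [e1, e2, e3, e4, e5, e6]

theorem K₁red_indep (s : ℕ → ℕ → ℂ) (sb : V → ℂ) :
    D.K₁red Δ (D.loopOf Δ h (D.indep Δ h c τ u)) (D.branchOf Δ h (D.indep Δ h c τ u)) s sb =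
      D.K₁red Δ (D.loopMand Δ τ) (D.branchMand Δ τ) s sb := by
  have hb : D.branchOf Δ h (D.indep Δ h c τ u) = D.branchMand Δ τ :=
    funext fun v => D.branchOf_indep hτ v
  rw [hb, K₁red, K₁red]
  refine congrArg (· * _) (Finset.prod_congr rfl fun a ha => Finset.prod_congr rfl fun b hb => ?_)
  obtain ⟨h1, h2⟩ := Finset.mem_Icc.1 ha
  obtain ⟨h3, h4⟩ := Finset.mem_Icc.1 hb
  have e1 := D.loopOf_indep hτ (b := b - 1) h1 (by omega)
  have e2 := D.loopOf_indep hτ (a := a + 1) (by omega) h4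
  have e3 := D.loopOf_indep hτ (a := a + 1) (b := b - 1) (by omega) (by omega)
  have e4 := D.loopOf_indep hτ h1 h4
  simp only [crossArg, e1, e2, e3, e4]

end Recover

/-! ### The integral over the variables that are free within the groups -/

theorem pairSums_zero (g : D.PairGroup) : D.pairSums (0 : D.Chan → ℝ) g = 0 := by
  have hl : ∀ a b, D.loopExt (0 : D.Chan → ℝ) a b = 0 := fun a b => by
    rw [loopExt]
    split_ifs <;> rfl
  have hb : ∀ v, D.branchExt (0 : D.Chan → ℝ) v = 0 := fun v => by
    rw [branchExt, hl]
    split_ifs <;> rfl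
  rcases g with x | v <;> simp [pairSums, hl, hb]

theorem lastSums_zero (a : {a : ℕ // 1 ≤ a ∧ a ≤ r}) : D.lastSums (0 : D.Chan → ℝ) a = 0 := by
  have hl : ∀ a b, D.loopExt (0 : D.Chan → ℝ) a b = 0 := fun a b => by
    rw [loopExt]
    split_ifs <;> rfl
  have hc : ∀ a, D.chainExt (0 : D.Chan → ℝ) a = 0 := fun v => by
    rw [chainExt]
    split_ifs <;> rfl
  simp [lastSums, hl, hc]

theorem indep_displace_of_sums {q : D.Chan → ℝ} {dτ : BPair n → ℝ} {du : Fin n → ℝ}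
    (hτ : ∀ g, ∑ p ∈ D.pairGroup g, dτ p = D.pairSums q g)
    (hu : ∀ a, ∑ k ∈ D.lastGroup a, du k = D.lastSums q a) :
    D.indep Δ h c (fun p => τ p + Complex.I * (dτ p : ℂ)) (fun k => u k + Complex.I * (du k : ℂ)) =
      fun x => D.indep Δ h c τ u x + Complex.I * ((-2 * q x : ℝ) : ℂ) := by
  ext x
  rw [indep_displace, D.chanCoord_of_sums hτ hu]

section Fibre

variable {ρ : D.PairGroup → BPair n} (hρ : ∀ g, ρ g ∈ D.pairGroup g)
  {κ : {a : ℕ // 1 ≤ a ∧ a ≤ r} → Fin n} (hκ : ∀ a, κ a ∈ D.lastGroup a)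
include hρ hκ

/-- Motion inside the groups leaves all group sums unchanged, so it is the displacement with channel
coordinates `0`. -/
theorem indep_contourPoint (w : FreeVar ρ → ℝ) (w' : FreeVar κ → ℝ) :
    D.indep Δ h c (contourPoint D.pairGroup ρ τ w) (contourPoint D.lastGroup κ u w') =
      D.indep Δ h c τ u := by
  refine (D.indep_displace_of_sums (q := 0)
    (fun g => (sum_shift D.mem_pairGroup_iff hρ w g).trans (D.pairSums_zero g).symm)
    (fun a => (sum_shift D.mem_lastGroup_iff hκ w' a).trans (D.lastSums_zero a).symm)).trans ?_
  ext x
  simp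

theorem tauConstraints_contourPoint (hτ : TauConstraints Δ h c τ u) (w : FreeVar ρ → ℝ)
    (w' : FreeVar κ → ℝ) :
    TauConstraints Δ h c (contourPoint D.pairGroup ρ τ w) (contourPoint D.lastGroup κ u w') :=
  hτ.displace
    (D.sum_eq_zero_of_pairSums (q := 0)
      fun g => (sum_shift D.mem_pairGroup_iff hρ w g).trans (D.pairSums_zero g).symm)
    (D.sum_eq_zero_of_lastSums (q := 0)
      fun a => (sum_shift D.mem_lastGroup_iff hκ w' a).trans (D.lastSums_zero a).symm)

/-- The integral over `u` depends on `τ` only through Mandelstam variables, so it is the same for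
every `w`. -/
theorem integral_fibre_K₂pre (hτ : TauConstraints Δ h c τ u) (hsep : Separating Δ δ τ u)
    (w : FreeVar ρ → ℝ) :
    ∫ w' : FreeVar κ → ℝ,
      K₂pre Δ (contourPoint D.pairGroup ρ τ w) (contourPoint D.lastGroup κ u w') =
      (2 * Real.pi) ^ Fintype.card (FreeVar κ) *
        K₂red (r := r) (D.chainOf h c (D.indep Δ h c τ u)) (D.loopOf Δ h (D.indep Δ h c τ u)) := by
  have hu : contourPoint D.lastGroup κ u 0 = u := by
    ext k
    simp [contourPoint, shift_zero]
  have hτ' := D.tauConstraints_contourPoint hρ hκ hτ w 0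
  have hi := D.indep_contourPoint (Δ := Δ) (h := h) (c := c) (τ := τ) (u := u) hρ hκ w 0
  rw [hu] at hτ' hi
  have hsep' : Separating Δ δ (contourPoint D.pairGroup ρ τ w) u := by
    have h0 : (fun k => u k + Complex.I * (((0 : Fin n → ℝ) k : ℝ) : ℂ)) = u := by
      ext k
      simp
    have := hsep.displace (shift D.pairGroup ρ w) 0
    rwa [h0] at this
  rw [integral_contour_eq, (D.contourIntegral_K₂pre hsep' h c hκ).2, ← hi, D.K₂red_indep hτ']

/-- `K₁pre` does not involve `u`: integrating over `u` first produces a constant, which then leaves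
the integral of `K₁pre` over `τ`. -/
theorem integral_fibre (hτ : TauConstraints Δ h c τ u) (hsep : Separating Δ δ τ u) (M : ℂ)
    (hint : Integrable fun w : (FreeVar ρ → ℝ) × (FreeVar κ → ℝ) =>
      M * (K₂pre Δ (contourPoint D.pairGroup ρ τ w.1) (contourPoint D.lastGroup κ u w.2) *
        K₁pre δ (contourPoint D.pairGroup ρ τ w.1))) :
    ∫ w : (FreeVar ρ → ℝ) × (FreeVar κ → ℝ),
      M * (K₂pre Δ (contourPoint D.pairGroup ρ τ w.1) (contourPoint D.lastGroup κ u w.2) *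
        K₁pre δ (contourPoint D.pairGroup ρ τ w.1)) =
      (2 * Real.pi) ^ (Fintype.card (FreeVar ρ) + Fintype.card (FreeVar κ)) *
        (M * D.Kred Δ h c δ (D.indep Δ h c τ u)) := by
  rw [Measure.volume_eq_prod] at hint ⊢
  rw [integral_prod _ hint]
  simp only [integral_const_mul, integral_mul_const, D.integral_fibre_K₂pre hρ hκ hτ hsep]
  rw [integral_contour_eq (K₁pre δ), (D.contourIntegral_K₁pre hsep hρ).2, Kred,
    D.K₁red_indep hτ, pow_add]
  ring

end Fibre

/-! ### The formula for the pre-amplitude -/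

section PreAmplitude

variable (p₀ : BPair n) (k₀ : Fin n)
  {ρ : D.PairGroup → BPair n} (hρ : ∀ g, ρ g ∈ D.pairGroup g)
  {κ : {a : ℕ // 1 ≤ a ∧ a ≤ r} → Fin n} (hκ : ∀ a, κ a ∈ D.lastGroup a)

theorem preIntegrand_mandelstamEquiv_symm (M₀ : (D.Chan → ℂ) → ℂ)
    (q : D.Chan → ℝ) (w : (FreeVar ρ → ℝ) × (FreeVar κ → ℝ)) :
    D.preIntegrand Δ h c δ M₀ p₀ k₀ τ u ((D.mandelstamEquiv p₀ k₀ hρ hκ).symm (q, w)) =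
      M₀ (fun x => D.indep Δ h c τ u x + Complex.I * ((-2 * q x : ℝ) : ℂ)) *
        (K₂pre Δ
          (contourPoint D.pairGroup ρ
            (fun p => τ p + Complex.I * (fill D.pairGroup ρ (D.pairSums q) 0 p : ℂ)) w.1)
          (contourPoint D.lastGroup κ
            (fun k => u k + Complex.I * (fill D.lastGroup κ (D.lastSums q) 0 k : ℂ)) w.2) *
        K₁pre δ (contourPoint D.pairGroup ρ
            (fun p => τ p + Complex.I * (fill D.pairGroup ρ (D.pairSums q) 0 p : ℂ)) w.1)) := by
  have hc := D.contourPoint_mandelstamEquiv_symm p₀ k₀ hρ hκ τ u (q, w)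
  simp only [preIntegrand]
  rw [hc.1, hc.2, contourPoint_fill, contourPoint_fill, D.indep_displace_of_sums
    (sum_fill D.mem_pairGroup_iff hρ (D.pairSums q) w.1)
    (sum_fill D.mem_lastGroup_iff hκ (D.lastSums q) w.2)]

theorem redIntegrand_smul (M₀ : (D.Chan → ℂ) → ℂ) (q : D.Chan → ℝ) :
    D.redIntegrand Δ h c δ M₀ τ u ((-2 : ℝ) • q) =
      M₀ (fun x => D.indep Δ h c τ u x + Complex.I * ((-2 * q x : ℝ) : ℂ)) *
        D.Kred Δ h c δ (fun x => D.indep Δ h c τ u x + Complex.I * ((-2 * q x : ℝ) : ℂ)) := rfl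

/-- The fibre over `q` is the grouped contour through the base point displaced by `fill` with zero
free part. The constraints and the positivity of real parts persist there, so the fibre integral
applies at that point. -/
theorem integral_preIntegrand_fibre (hτ : TauConstraints Δ h c τ u) (hsep : Separating Δ δ τ u)
    (M₀ : (D.Chan → ℂ) → ℂ) (q : D.Chan → ℝ)
    (hint : Integrable fun w : (FreeVar ρ → ℝ) × (FreeVar κ → ℝ) =>
      D.preIntegrand Δ h c δ M₀ p₀ k₀ τ u ((D.mandelstamEquiv p₀ k₀ hρ hκ).symm (q, w))) :
    ∫ w : (FreeVar ρ → ℝ) × (FreeVar κ → ℝ),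
      D.preIntegrand Δ h c δ M₀ p₀ k₀ τ u ((D.mandelstamEquiv p₀ k₀ hρ hκ).symm (q, w)) =
      (2 * Real.pi) ^ (Fintype.card (FreeVar ρ) + Fintype.card (FreeVar κ)) *
        D.redIntegrand Δ h c δ M₀ τ u ((-2 : ℝ) • q) := by
  have hsτ := sum_fill D.mem_pairGroup_iff hρ (D.pairSums q) 0
  have hsu := sum_fill D.mem_lastGroup_iff hκ (D.lastSums q) 0
  simp only [preIntegrand_mandelstamEquiv_symm] at hint ⊢
  rw [D.integral_fibre hρ hκ
    (hτ.displace (D.sum_eq_zero_of_pairSums hsτ) (D.sum_eq_zero_of_lastSums hsu))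
    (hsep.displace _ _) _ hint, D.indep_displace_of_sums hsτ hsu, redIntegrand_smul]

include hρ hκ in
theorem preAmplitude_eq_aux (hτ : TauConstraints Δ h c τ u) (hsep : Separating Δ δ τ u)
    (M₀ : (D.Chan → ℂ) → ℂ) (hint : Integrable (D.preIntegrand Δ h c δ M₀ p₀ k₀ τ u)) :
    Integrable (D.redIntegrand Δ h c δ M₀ τ u) ∧
      D.preAmplitude Δ h c δ M₀ p₀ k₀ τ u =
        (1 / 2 : ℂ) ^ Fintype.card D.Chan * D.redIntegral Δ h c δ M₀ τ u := by
  set N := Fintype.card (FreeVar ρ) + Fintype.card (FreeVar κ) with hN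
  have hπ : (2 * Real.pi : ℂ) ≠ 0 := by
    have : (Real.pi : ℂ) ≠ 0 := by exact_mod_cast Real.pi_ne_zero
    simp [this]
  obtain ⟨hred, hI⟩ := integral_eq_of_fibre (D.mandelstamEquiv p₀ k₀ hρ hκ)
    (D.measurePreserving_mandelstamEquiv p₀ k₀ hρ hκ) (pow_ne_zero N hπ) hint
    (R := D.redIntegrand Δ h c δ M₀ τ u)
    fun q hq => D.integral_preIntegrand_fibre p₀ k₀ hρ hκ hτ hsep M₀ q hq
  refine ⟨hred, ?_⟩
  rw [preAmplitude, hI, redIntegral, D.card_freeVar_add_card_freeVar p₀ k₀ hρ hκ, ← hN, pow_add]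
  have : (1 / (2 * Real.pi : ℂ)) ^ N * (2 * Real.pi) ^ N = 1 := by
    rw [← mul_pow, one_div, inv_mul_cancel₀ hπ, one_pow]
  linear_combination ((1 / (2 * Real.pi : ℂ)) ^ Fintype.card D.Chan *
    ((1 / 2 : ℂ) ^ Fintype.card D.Chan * ∫ t, D.redIntegrand Δ h c δ M₀ τ u t)) * this

/-- The pivots inside the groups are auxiliary and occur in neither side; non-emptiness of the
groups supplies some choice. -/
theorem preAmplitude_eq (hτ : TauConstraints Δ h c τ u) (hsep : Separating Δ δ τ u)
    (M₀ : (D.Chan → ℂ) → ℂ) (hint : Integrable (D.preIntegrand Δ h c δ M₀ p₀ k₀ τ u)) :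
    Integrable (D.redIntegrand Δ h c δ M₀ τ u) ∧
      D.preAmplitude Δ h c δ M₀ p₀ k₀ τ u =
        (1 / 2 : ℂ) ^ Fintype.card D.Chan * D.redIntegral Δ h c δ M₀ τ u := by
  choose ρ hρ using D.pairGroup_nonempty
  choose κ hκ using fun a : {a : ℕ // 1 ≤ a ∧ a ≤ r} => D.segPts_self_nonempty a.2.1 a.2.2
  exact D.preAmplitude_eq_aux p₀ k₀ hρ hκ hτ hsep M₀ hint

end PreAmplitude

end OneLoopDiagram

end WittenMellin

theorem mainTheorem7 {n r : ℕ} {V : Type*} [Fintype V] (D : OneLoopDiagram n r V)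
    (Δ : Fin n → ℂ) (h : ℝ) (c : ℂ) (δ : BPair n → ℂ) (hδ : Canonical Δ δ)
    (τ₀ : BPair n → ℂ) (u₀ : Fin n → ℂ) (hτ : TauConstraints Δ h c τ₀ u₀)
    (hsep : Separating Δ δ τ₀ u₀) :
    -- the part `K₂`: integration over the `τ_{k,n+1}` at fixed Mandelstam variables
    (∀ κ : {a : ℕ // 1 ≤ a ∧ a ≤ r} → Fin n, (∀ a, κ a ∈ D.lastGroup a) →
      ContourIntegrable D.lastGroup κ (K₂pre Δ τ₀) u₀ ∧
      contourIntegral D.lastGroup κ (K₂pre Δ τ₀) u₀ =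
        OneLoopDiagram.K₂red (r := r) (D.chainMand Δ h c τ₀ u₀) (D.loopMand Δ τ₀)) ∧
    -- the part `K₁`: integration over the `τ_ij` at fixed Mandelstam variables
    (∀ ρ : D.PairGroup → BPair n, (∀ g, ρ g ∈ D.pairGroup g) →
      ContourIntegrable D.pairGroup ρ (K₁pre δ) τ₀ ∧
      contourIntegral D.pairGroup ρ (K₁pre δ) τ₀ =
        D.K₁red Δ (D.loopMand Δ τ₀) (D.branchMand Δ τ₀) (D.loopMand Δ δ) (D.branchMand Δ δ)) ∧
    -- the resulting formula for the pre-amplitude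
    (∀ (p₀ : BPair n) (k₀ : Fin n) (M₀ : (D.Chan → ℂ) → ℂ),
      MeasureTheory.Integrable (D.preIntegrand Δ h c δ M₀ p₀ k₀ τ₀ u₀) →
      MeasureTheory.Integrable (D.redIntegrand Δ h c δ M₀ τ₀ u₀) ∧
      D.preAmplitude Δ h c δ M₀ p₀ k₀ τ₀ u₀ =
        (1 / 2 : ℂ) ^ Fintype.card D.Chan * D.redIntegral Δ h c δ M₀ τ₀ u₀) := by
  exact ⟨fun κ hκ => D.contourIntegral_K₂pre hsep h c hκ,
    fun ρ hρ => D.contourIntegral_K₁pre hsep hρ,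
    fun p₀ k₀ M₀ hint => D.preAmplitude_eq p₀ k₀ hτ hsep M₀ hint⟩
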